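/- Let $k$ be an algebraically closed field and let $\mathcal C$ be a braided finite tensor category over $k$: a $k$-linear abelian category with finite-dimensional morphism spaces, all objects of finite length, enough projectives and finitely many isomorphism classes of simple objects, equipped with a rigid monoidal structure with bilinear tensor product and simple unit $\mathbf 1$, and with a braiding $\beta_{x,c}\colon x\otimes c\to c\otimes x$. (Associativity and unit constraints, and the canonical isomorphisms $y^\vee\otimes x^\vee\cong(x\otimes y)^\vee$ and $\mathbf 1\cong\mathbf 1^\vee$, are suppressed in the formulas.) Write $x^\vee$ for the right dual of $x$, with $\mathrm{ev}_x\colon x^\vee\otimes x\to\mathbf 1$ and $\mathrm{coev}_x\colon\mathbf 1\to x\otimes x^\vee$. A bimonad on $\mathcal C$ is a monad whose endofunctor carries a comonoidal structure such that multiplication and unit are comonoidal; a morphism of bimonads is a comonoidal morphism of monads. For every $c\in\mathcal C$ the coend $Z(c)=\int^{x\in\mathcal C}x^\vee\otimes c\otimes x$ exists. Let $i^c_x\colon x^\vee\otimes c\otimes x\to Z(c)$ be its universal dinatural family, $Z$ the resulting endofunctor, $L=Z(\mathbf 1)$ and $i_x=i^{\mathbf 1}_x\colon x^\vee\otimes x\to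 L$. Then: (a) There is a unique bimonad structure $(\mathrm m,\mathrm e,\Delta^Z,\varepsilon^Z)$ on $Z$ with $$\mathrm e_c=i^c_{\mathbf 1},\qquad \mathrm m_c\circ i^{Z(c)}_y\circ(\mathrm{id}_{y^\vee}\otimes i^c_x\otimes\mathrm{id}_y)=i^c_{x\otimes y},\qquad \varepsilon^Z\circ i^{\mathbf 1}_x=\mathrm{ev}_x,$$ $$\Delta^Z_{c,c'}\circ i^{c\otimes c'}_x=(i^c_x\otimes i^{c'}_x)\circ(\mathrm{id}_{x^\vee}\otimes\mathrm{id}_c\otimes\mathrm{coev}_x\otimes\mathrm{id}_{c'}\otimes\mathrm{id}_x).$$ (b) There is a unique bialgebra structure $(\mu,\eta,\Delta,\varepsilon)$ on $L$ in $\mathcal C$ with $$\mu\circ(i_x\otimes i_y)=i_{y\otimes x}\circ(\mathrm{id}_{x^\vee}\otimes\beta_{x,y^\vee\otimes y}),\qquad \eta=i_{\mathbf 1},$$ $$\Delta\circ i_x=(i_x\otimes i_x)\circ(\mathrm{id}_{x^\vee}\otimes\mathrm{coev}_x\otimes\mathrm{id}_x),\qquad \varepsilon\circ i_x=\mathrm{ev}_x.$$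 (c) Regard $L\otimes-$ as a bimonad with multiplication $\mu\otimes\mathrm{id}_c$, unit $\eta\otimes\mathrm{id}_c$, counit $\varepsilon$ and coproduct $(\mathrm{id}_L\otimes\beta_{L,c}\otimes\mathrm{id}_{c'})\circ(\Delta\otimes\mathrm{id}_c\otimes\mathrm{id}_{c'})$. Then $Z$ and $L\otimes-$ are isomorphic as bimonads: there are mutually inverse natural transformations $\zeta\colon L\otimes-\Rightarrow Z$ and $\xi\colon Z\Rightarrow L\otimes-$, both morphisms of bimonads, such that for all $c,x\in\mathcal C$ $$\zeta_c\circ(i_x\otimes\mathrm{id}_c)=i^c_x\circ(\mathrm{id}_{x^\vee}\otimes\beta_{x,c}),\qquad \xi_c\circ i^c_x=(i_x\otimes\mathrm{id}_c)\circ(\mathrm{id}_{x^\vee}\otimes\beta_{x,c}^{-1}).$$ -/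

import Mathlib

open CategoryTheory Limits MonoidalCategory Opposite

universe w v u

noncomputable section

namespace BraidedFTC

section Finite

variable (k : Type w) [Field k] (C : Type u) [Category.{v} C] [Abelian C] [Linear k C]

/-- A `k`-linear abelian category is finite if its morphism spaces are finite-dimensional, every
object has finite length (i.e. satisfies both chain conditions on subobjects), there are enough
projectives, and there are finitely many isomorphism classes of simple objects. -/
class IsFiniteLinearCategory : Prop where
  finite_hom : ∀ X Y : C, Module.Finite k (X ⟶ Y)
  noetherian : ∀ X : C, IsNoetherianObject X
  artinian : ∀ X : C, IsArtinianObject X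
  enoughProjectives : EnoughProjectives C
  finite_simples : ∃ (n : ℕ) (S : Fin n → C), ∀ X : C, Simple X → ∃ i, Nonempty (X ≅ S i)

/-- A finite tensor category: a finite linear category with a rigid monoidal structure, the tensor
product being bilinear on morphisms, and with simple tensor unit. -/
class IsFiniteTensorCategory [MonoidalCategory C] [MonoidalPreadditive C] [MonoidalLinear k C]
    [RigidCategory C] : Prop extends IsFiniteLinearCategory k C where
  simple_unit : Simple (𝟙_ C)

end Finite

section Bimonads

variable {C : Type u} [Category.{v} C] [MonoidalCategory C]

/-- A bimonad structure on an endofunctor `T` of a monoidal category: a monad structure and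
a comonoidal (i.e. oplax monoidal) structure on `T` such that the multiplication and the unit of
the monad are comonoidal natural transformations. -/
@[ext]
structure BimonadStr (T : C ⥤ C) where
  /-- the unit of the monad -/
  e : 𝟭 C ⟶ T
  /-- the multiplication of the monad -/
  m : T ⋙ T ⟶ T
  assoc : ∀ X : C, T.map (m.app X) ≫ m.app X = m.app (T.obj X) ≫ m.app X
  left_unit : ∀ X : C, e.app (T.obj X) ≫ m.app X = 𝟙 (T.obj X)
  right_unit : ∀ X : C, T.map (e.app X) ≫ m.app X = 𝟙 (T.obj X)
  /-- the comonoidal structure, with counit `oplax.η` and coproduct `oplax.δ` -/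
  oplax : T.OplaxMonoidal
  e_counit : e.app (𝟙_ C) ≫ oplax.η = 𝟙 (𝟙_ C)
  e_comul : ∀ X Y : C, e.app (X ⊗ Y) ≫ oplax.δ X Y = e.app X ⊗ₘ e.app Y
  m_counit : m.app (𝟙_ C) ≫ oplax.η = T.map oplax.η ≫ oplax.η
  m_comul : ∀ X Y : C, m.app (X ⊗ Y) ≫ oplax.δ X Y =
    T.map (oplax.δ X Y) ≫ oplax.δ (T.obj X) (T.obj Y) ≫ (m.app X ⊗ₘ m.app Y)

/-- The counit `T 𝟙 ⟶ 𝟙` of a bimonad. -/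
def BimonadStr.counit {T : C ⥤ C} (B : BimonadStr T) : T.obj (𝟙_ C) ⟶ 𝟙_ C := B.oplax.η

/-- The coproduct `T (X ⊗ Y) ⟶ T X ⊗ T Y` of a bimonad. -/
def BimonadStr.comul {T : C ⥤ C} (B : BimonadStr T) (X Y : C) :
    T.obj (X ⊗ Y) ⟶ T.obj X ⊗ T.obj Y := B.oplax.δ X Y

/-- A natural transformation between the endofunctors underlying two bimonads is a morphism of
bimonads if it is a morphism of monads and a comonoidal natural transformation. -/
structure IsBimonadHom {S T : C ⥤ C} (A : BimonadStr S) (B : BimonadStr T) (f : S ⟶ T) :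
    Prop where
  unit : ∀ X : C, A.e.app X ≫ f.app X = B.e.app X
  mul : ∀ X : C, A.m.app X ≫ f.app X = S.map (f.app X) ≫ f.app (T.obj X) ≫ B.m.app X
  counit : f.app (𝟙_ C) ≫ B.counit = A.counit
  comul : ∀ X Y : C, f.app (X ⊗ Y) ≫ B.comul X Y = A.comul X Y ≫ (f.app X ⊗ₘ f.app Y)

end Bimonads

section TensorBimonad

variable {C : Type u} [Category.{v} C] [MonoidalCategory C] [BraidedCategory C]

/-- The comonoidal structure on the endofunctor `A ⊗ -` of a braided monoidal category that is
defined by a coalgebra `A`: the counit is the one of `A`, and the coproduct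
`A ⊗ X ⊗ Y ⟶ A ⊗ A ⊗ X ⊗ Y ⟶ A ⊗ X ⊗ A ⊗ Y` is the comultiplication of `A` followed by the
braiding `A ⊗ X ⟶ X ⊗ A` of the second copy of `A` with `X` (which is `tensorμ A A X Y`). -/
abbrev tensorOplax (A : C) [ComonObj A] : (tensorLeft A).OplaxMonoidal where
  η := (ρ_ A).hom ≫ ComonObj.counit
  δ X Y := ComonObj.comul ▷ (X ⊗ Y) ≫ tensorμ A A X Y
  δ_natural_left {X Y} f X' := by
    have h := tensorμ_natural_right A A f (𝟙 X')
    simp only [tensorHom_id, whiskerLeft_id] at h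
    simp only [curriedTensor_obj_obj, curriedTensor_obj_map, Category.assoc, ← h]
    rw [← whisker_exchange_assoc]
  δ_natural_right {X Y} X' f := by
    have h := tensorμ_natural_right A A (𝟙 X') f
    simp only [id_tensorHom, whiskerLeft_id] at h
    simp only [curriedTensor_obj_obj, curriedTensor_obj_map, Category.assoc, ← h]
    rw [← whisker_exchange_assoc]
  oplax_associativity X Y Z := by
    have h1 := tensorμ_natural_left (ComonObj.comul (X := A)) (𝟙 A) (X ⊗ Y) Z
    have h2 := tensorμ_natural_left (𝟙 A) (ComonObj.comul (X := A)) X (Y ⊗ Z)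
    have h3 := associator_monoidal A A A X Y Z
    simp only [tensorHom_id, id_whiskerRight, id_tensorHom] at h1 h2
    simp only [curriedTensor_obj_obj, curriedTensor_obj_map, Category.assoc,
      comp_whiskerRight, MonoidalCategory.whiskerLeft_comp]
    rw [← reassoc_of% h1, ← reassoc_of% h2, h3, tensorHom_def'_assoc,
      ← whisker_exchange_assoc, ← whisker_exchange_assoc]
    simp only [← comp_whiskerRight_assoc]
    rw [ComonObj.comul_assoc]
  oplax_left_unitality X := by
    have h1 := tensorμ_natural_left (ComonObj.counit (X := A)) (𝟙 A) (𝟙_ C) X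
    have h2 := leftUnitor_monoidal A X
    simp only [tensorHom_id, id_whiskerRight] at h1
    have h3 : (ComonObj.comul (X := A) ▷ (𝟙_ C ⊗ X) ≫ tensorμ A A (𝟙_ C) X) ≫
        ((ρ_ A).hom ≫ ComonObj.counit) ▷ (A ⊗ X) = A ◁ (λ_ X).hom ≫ (λ_ (A ⊗ X)).inv := by
      have h4 : ((ρ_ A).hom ≫ ComonObj.counit (X := A)) ▷ (A ⊗ X) =
          (ComonObj.counit (X := A) ▷ 𝟙_ C ⊗ₘ 𝟙 (A ⊗ X)) ≫ (λ_ (𝟙_ C)).hom ▷ (A ⊗ X) := by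
        rw [← rightUnitor_naturality, unitors_equal]
        simp
      rw [h4, Category.assoc]
      simp only [tensorHom_id]
      rw [← reassoc_of% h1, ← comp_whiskerRight_assoc,
        ComonObj.counit_comul, ← Category.comp_id (tensorμ (𝟙_ C) A (𝟙_ C) X ≫ _),
        ← Iso.hom_inv_id (λ_ (A ⊗ X)), Category.assoc, ← reassoc_of% h2]
      monoidal
    simp only [curriedTensor_obj_obj, curriedTensor_obj_map]
    rw [h3, ← MonoidalCategory.whiskerLeft_comp_assoc]
    simp
  oplax_right_unitality X := by
    have h1 := tensorμ_natural_left (𝟙 A) (ComonObj.counit (X := A)) X (𝟙_ C)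
    have h2 := rightUnitor_monoidal A X
    simp only [id_tensorHom, id_whiskerRight] at h1
    have h3 : (ComonObj.comul (X := A) ▷ (X ⊗ 𝟙_ C) ≫ tensorμ A A X (𝟙_ C)) ≫
        (A ⊗ X) ◁ ((ρ_ A).hom ≫ ComonObj.counit) = A ◁ (ρ_ X).hom ≫ (ρ_ (A ⊗ X)).inv := by
      have h4 : (A ⊗ X) ◁ ((ρ_ A).hom ≫ ComonObj.counit (X := A)) =
          (𝟙 (A ⊗ X) ⊗ₘ ComonObj.counit (X := A) ▷ 𝟙_ C) ≫ (A ⊗ X) ◁ (λ_ (𝟙_ C)).hom := by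
        rw [← rightUnitor_naturality, unitors_equal]
        simp
      rw [h4, Category.assoc]
      simp only [id_tensorHom]
      rw [← reassoc_of% h1, ← comp_whiskerRight_assoc,
        ComonObj.comul_counit, ← Category.comp_id (tensorμ A (𝟙_ C) X (𝟙_ C) ≫ _),
        ← Iso.hom_inv_id (ρ_ (A ⊗ X)), Category.assoc, ← reassoc_of% h2]
      monoidal
    simp only [curriedTensor_obj_obj, curriedTensor_obj_map]
    rw [h3, ← MonoidalCategory.whiskerLeft_comp_assoc]
    simp

/-- The bimonad `A ⊗ -` on a braided monoidal category that is defined by a bialgebra `A`. -/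
def tensorBimonad (A : C) [BimonObj A] : BimonadStr (tensorLeft A) where
  e :=
    { app := fun X => (λ_ X).inv ≫ MonObj.one ▷ X
      naturality := by
        intro X Y f
        simp [← whisker_exchange] }
  m :=
    { app := fun X => (α_ A A X).inv ≫ MonObj.mul ▷ X
      naturality := by
        intro X Y f
        simp [← whisker_exchange] }
  assoc X := by
    change A ◁ ((α_ A A X).inv ≫ MonObj.mul ▷ X) ≫ (α_ A A X).inv ≫ MonObj.mul ▷ X =
      ((α_ A A (A ⊗ X)).inv ≫ MonObj.mul ▷ (A ⊗ X)) ≫ (α_ A A X).inv ≫ MonObj.mul ▷ X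
    have h : (MonObj.mul (X := A) ▷ A) ▷ X ≫ MonObj.mul ▷ X = _ :=
      (comp_whiskerRight _ _ _).symm.trans (congrArg (· ▷ X) (MonObj.mul_assoc A))
    simp only [comp_whiskerRight] at h
    simp only [MonoidalCategory.whiskerLeft_comp, Category.assoc,
      associator_inv_naturality_left_assoc, associator_inv_naturality_middle_assoc, h]
    monoidal
  left_unit X := by
    change ((λ_ (A ⊗ X)).inv ≫ MonObj.one ▷ (A ⊗ X)) ≫ (α_ A A X).inv ≫ MonObj.mul ▷ X =
      𝟙 (A ⊗ X)
    rw [Category.assoc, associator_inv_naturality_left_assoc, ← comp_whiskerRight,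
      MonObj.one_mul]
    monoidal
  right_unit X := by
    change A ◁ ((λ_ X).inv ≫ MonObj.one ▷ X) ≫ (α_ A A X).inv ≫ MonObj.mul ▷ X = 𝟙 (A ⊗ X)
    rw [MonoidalCategory.whiskerLeft_comp, Category.assoc,
      associator_inv_naturality_middle_assoc, ← comp_whiskerRight, MonObj.mul_one]
    monoidal
  oplax := tensorOplax A
  e_counit := by
    change ((λ_ (𝟙_ C)).inv ≫ MonObj.one ▷ 𝟙_ C) ≫ (ρ_ A).hom ≫ ComonObj.counit = 𝟙 (𝟙_ C)
    rw [Category.assoc, rightUnitor_naturality_assoc, BimonObj.one_counit]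
    monoidal
  e_comul X Y := by
    change ((λ_ (X ⊗ Y)).inv ≫ MonObj.one ▷ (X ⊗ Y)) ≫ ComonObj.comul ▷ (X ⊗ Y) ≫
      tensorμ A A X Y = ((λ_ X).inv ≫ MonObj.one ▷ X) ⊗ₘ ((λ_ Y).inv ≫ MonObj.one ▷ Y)
    have h := tensorμ_natural_left (MonObj.one (X := A)) (MonObj.one (X := A)) X Y
    have h2 := tensor_left_unitality X Y
    rw [Category.assoc, ← comp_whiskerRight_assoc, BimonObj.one_comul,
      MonObj.tensorObj.one_def, comp_whiskerRight_assoc, h, ← tensorHom_comp_tensorHom]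
    simp only [← Category.assoc]
    congr 1
    have h3 : ((λ_ X).inv ⊗ₘ (λ_ Y).inv) =
        (λ_ (X ⊗ Y)).inv ≫ (λ_ (X ⊗ Y)).hom ≫ ((λ_ X).inv ⊗ₘ (λ_ Y).inv) := by simp
    rw [h3, h2]
    simp [tensorHom_comp_tensorHom]
  m_counit := by
    change ((α_ A A (𝟙_ C)).inv ≫ MonObj.mul ▷ 𝟙_ C) ≫ (ρ_ A).hom ≫ ComonObj.counit =
      A ◁ ((ρ_ A).hom ≫ ComonObj.counit) ≫ (ρ_ A).hom ≫ ComonObj.counit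
    rw [Category.assoc, rightUnitor_naturality_assoc, BimonObj.mul_counit]
    have h : ComonObj.counit (X := A ⊗ A) =
        (ComonObj.counit (X := A) ⊗ₘ ComonObj.counit (X := A)) ≫ (λ_ (𝟙_ C)).hom :=
      Comon.tensorObj_counit A A
    rw [h, tensorHom_def', Category.assoc, unitors_equal, rightUnitor_naturality]
    monoidal
  m_comul X Y := by
    change ((α_ A A (X ⊗ Y)).inv ≫ MonObj.mul ▷ (X ⊗ Y)) ≫ ComonObj.comul ▷ (X ⊗ Y) ≫
        tensorμ A A X Y =
      A ◁ (ComonObj.comul ▷ (X ⊗ Y) ≫ tensorμ A A X Y) ≫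
        (ComonObj.comul ▷ ((A ⊗ X) ⊗ (A ⊗ Y)) ≫ tensorμ A A (A ⊗ X) (A ⊗ Y)) ≫
          (((α_ A A X).inv ≫ MonObj.mul ▷ X) ⊗ₘ ((α_ A A Y).inv ≫ MonObj.mul ▷ Y))
    have h1 := tensorμ_natural_left (MonObj.mul (X := A)) (MonObj.mul (X := A)) X Y
    have h2 := tensor_associativity A A A A X Y
    rw [Category.assoc, ← comp_whiskerRight_assoc, BimonObj.mul_comul]
    simp only [comp_whiskerRight, Category.assoc]
    rw [h1, ← tensorHom_comp_tensorHom]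
    have h3 : tensorμ A A A A ▷ (X ⊗ Y) ≫ tensorμ (A ⊗ A) (A ⊗ A) X Y =
        (α_ (A ⊗ A) (A ⊗ A) (X ⊗ Y)).hom ≫ (A ⊗ A) ◁ tensorμ A A X Y ≫
          tensorμ A A (A ⊗ X) (A ⊗ Y) ≫ ((α_ A A X).inv ⊗ₘ (α_ A A Y).inv) := by
      rw [← reassoc_of% h2]
      simp [tensorHom_comp_tensorHom]
    rw [reassoc_of% h3]
    have h4 : (α_ A A (X ⊗ Y)).inv ≫
        (ComonObj.comul (X := A) ⊗ₘ ComonObj.comul (X := A)) ▷ (X ⊗ Y) ≫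
          (α_ (A ⊗ A) (A ⊗ A) (X ⊗ Y)).hom =
        A ◁ (ComonObj.comul ▷ (X ⊗ Y)) ≫ ComonObj.comul ▷ ((A ⊗ A) ⊗ (X ⊗ Y)) := by
      rw [tensorHom_def']
      simp
    rw [reassoc_of% h4, MonoidalCategory.whiskerLeft_comp, Category.assoc,
      ← whisker_exchange_assoc]

end TensorBimonad

section Central

variable {C : Type u} [Category.{v} C] [MonoidalCategory C] [RightRigidCategory C]

/-- The functor `(x, y) ↦ xᘁ ⊗ c ⊗ y`, contravariant in `x` and covariant in `y`. -/
def centralBifunctor (c : C) : Cᵒᵖ ⥤ C ⥤ C where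
  obj x := tensorLeft c ⋙ tensorLeft (x.unop)ᘁ
  map f :=
    { app := fun y => rightAdjointMate f.unop ▷ (c ⊗ y)
      naturality := fun _ _ g => whisker_exchange (rightAdjointMate f.unop) (c ◁ g) }
  map_id := by
    intro x
    ext y
    simp
  map_comp := by
    intro x y z f g
    ext t
    simp [comp_rightAdjointMate]

variable (C) in
/-- A choice, for every object `c`, of a coend of `(x, y) ↦ xᘁ ⊗ c ⊗ y`, i.e. of a universal
dinatural family `xᘁ ⊗ c ⊗ x ⟶ Z c`. -/
structure CentralCoends where
  cowedge (c : C) : Cowedge (centralBifunctor c)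
  isColimit (c : C) : IsColimit (cowedge c)

namespace CentralCoends

variable (D : CentralCoends C)

/-- The dinatural family `xᘁ ⊗ c ⊗ x ⟶ Z c` of the coend `Z c`. -/
def ι (c x : C) : xᘁ ⊗ (c ⊗ x) ⟶ (D.cowedge c).pt := (D.cowedge c).π x

lemma ι_dinatural (c : C) {x y : C} (f : x ⟶ y) :
    (fᘁ) ▷ (c ⊗ x) ≫ D.ι c x = yᘁ ◁ (c ◁ f) ≫ D.ι c y :=
  (D.cowedge c).condition f

lemma hom_ext {c d : C} {f g : (D.cowedge c).pt ⟶ d} (h : ∀ x, D.ι c x ≫ f = D.ι c x ≫ g) :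
    f = g :=
  Cowedge.IsColimit.hom_ext (D.isColimit c) h

/-- The action of the endofunctor `Z` on morphisms, induced by functoriality of the coends. -/
def map {c d : C} (f : c ⟶ d) : (D.cowedge c).pt ⟶ (D.cowedge d).pt :=
  Cowedge.IsColimit.desc (D.isColimit c) (fun x => xᘁ ◁ (f ▷ x) ≫ D.ι d x) (by
    intro x y g
    change gᘁ ▷ (c ⊗ x) ≫ xᘁ ◁ (f ▷ x) ≫ D.ι d x = yᘁ ◁ (c ◁ g) ≫ yᘁ ◁ (f ▷ y) ≫ D.ι d y
    rw [← whisker_exchange_assoc, ι_dinatural, ← whiskerLeft_comp_assoc,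
      ← whiskerLeft_comp_assoc, whisker_exchange])

lemma ι_map {c d : C} (f : c ⟶ d) (x : C) : D.ι c x ≫ D.map f = xᘁ ◁ (f ▷ x) ≫ D.ι d x :=
  Cowedge.IsColimit.π_desc (D.isColimit c) _ _ x

/-- The endofunctor `Z`, given on objects by the coend `Z c = ∫^x xᘁ ⊗ c ⊗ x`. -/
def Z : C ⥤ C where
  obj c := (D.cowedge c).pt
  map f := D.map f
  map_id c := D.hom_ext fun x => by simp [ι_map]
  map_comp f g := D.hom_ext fun x => by
    rw [ι_map, ← Category.assoc, ι_map, Category.assoc, ι_map]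
    simp

/-- The dinatural family of `Z c`, as a family of morphisms to the value of the functor `Z`. -/
def i (c x : C) : xᘁ ⊗ (c ⊗ x) ⟶ D.Z.obj c := D.ι c x

/-- The object `L = Z 𝟙`. -/
def L : C := D.Z.obj (𝟙_ C)

/-- The dinatural family `xᘁ ⊗ x ⟶ L` of `L = Z 𝟙`. -/
def iL (x : C) : xᘁ ⊗ x ⟶ D.L := xᘁ ◁ (λ_ x).inv ≫ D.i (𝟙_ C) x

end CentralCoends

variable (C) in
/-- The canonical isomorphism between the unit and its dual. -/
def unitDual : 𝟙_ C ≅ (RightRigidCategory.rightDual (𝟙_ C)).rightDual :=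
  rightDualIso exactPairingUnit (RightRigidCategory.rightDual (𝟙_ C)).exact

/-- The canonical isomorphism between `yᘁ ⊗ xᘁ` and the dual of `x ⊗ y`. -/
def tensorDual (x y : C) : yᘁ ⊗ xᘁ ≅ (x ⊗ y)ᘁ :=
  rightDualIso ExactPairing.tensor HasRightDual.exact

/-- A bimonad structure on `Z` is the one of the central monad if its structure morphisms are
given by the defining formulas on the dinatural families. -/
structure IsCentralBimonad (D : CentralCoends C) (B : BimonadStr D.Z) : Prop where
  unit : ∀ c : C, B.e.app c =
    (𝟙 c ⊗≫ (unitDual C).hom ▷ (c ⊗ 𝟙_ C)) ≫ D.i c (𝟙_ C)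
  mul : ∀ c x y : C, yᘁ ◁ (D.i c x ▷ y) ≫ D.i (D.Z.obj c) y ≫ B.m.app c =
    (𝟙 (yᘁ ⊗ ((xᘁ ⊗ (c ⊗ x)) ⊗ y)) ⊗≫ (tensorDual x y).hom ▷ (c ⊗ (x ⊗ y))) ≫ D.i c (x ⊗ y)
  counit : ∀ x : C, D.i (𝟙_ C) x ≫ B.counit = xᘁ ◁ (λ_ x).hom ≫ ε_ x xᘁ
  comul : ∀ c d x : C, D.i (c ⊗ d) x ≫ B.comul c d =
    𝟙 (xᘁ ⊗ ((c ⊗ d) ⊗ x)) ⊗≫ xᘁ ◁ (c ◁ (η_ x xᘁ ▷ (d ⊗ x))) ⊗≫ (D.i c x ⊗ₘ D.i d x)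

open scoped MonObj ComonObj in
/-- A bialgebra structure on `L` is the canonical one if its structure morphisms are given by the
defining formulas on the dinatural family. -/
structure IsCanonicalBialgebra [BraidedCategory C] (D : CentralCoends C) (B : BimonObj D.L) :
    Prop where
  one : η[D.L] = (𝟙 (𝟙_ C) ⊗≫ (unitDual C).hom ▷ 𝟙_ C) ≫ D.iL (𝟙_ C)
  mul : ∀ x y : C, (D.iL x ⊗ₘ D.iL y) ≫ μ[D.L] =
    (𝟙 ((xᘁ ⊗ x) ⊗ (yᘁ ⊗ y)) ⊗≫ xᘁ ◁ (β_ x (yᘁ ⊗ y)).hom ⊗≫ (tensorDual y x).hom ▷ (y ⊗ x)) ≫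
      D.iL (y ⊗ x)
  counit : ∀ x : C, D.iL x ≫ ε[D.L] = ε_ x xᘁ
  comul : ∀ x : C, D.iL x ≫ Δ[D.L] =
    𝟙 (xᘁ ⊗ x) ⊗≫ xᘁ ◁ (η_ x xᘁ ▷ x) ⊗≫ (D.iL x ⊗ₘ D.iL x)

end Central

end BraidedFTC

end

/-! Existence of the coends: a finite linear category has a projective generator `P`. If a bifunctor
`F` is linear in both variables and right exact in the covariant one, its coend is the quotient of
`F(P, P)` by the dinaturality relations for a finite basis of `End P` (`exists_isColimit_cowedge`).
Rigidity makes `xᘁ ⊗ c ⊗ -` right exact.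

Everything else is done after transposing `xᘁ ⊗ c ⊗ x ⟶ Z c` to a square `D.r c x : c ⊗ x ⟶ x ⊗ Z
c`. Dinaturality becomes naturality in `x`, and `Z c` is universal among natural families `c ⊗ x ⟶ x
⊗ d`. Since objects have duals, this universality survives tensoring with an object on the right
(`exists_desc_tensor`, `r_jointlyEpi`). Squares are pasted along `x` by `vcomp` and along `c` by
`hcomp`, subject to the interchange law `hcomp_vcomp`. In these terms the multiplication sends a
vertical pasting of two squares `D.r` to `D.r` at a tensor product, the coproduct sends `D.r (c ⊗ d)
x` to a horizontal pasting, and unit and counit come from the unit object. Each bimonad axiom is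
then an identity of pastings, tested on a jointly epimorphic family; compatibility of multiplication
and coproduct is the interchange law.

The inverse braiding gives squares compatible with both pastings, by the two hexagons. Pasting them
to `D.r d x` yields an isomorphism `Z d ⊗ c ≅ Z (d ⊗ c)`, and `d = 𝟙_ C` gives `ζ`. The formula for
`μ` amounts to `μ = ζ_L ≫ m_𝟙`, so once `ζ` is known to respect the structures (`zeta_mul`,
`zeta_comul`), the bialgebra axioms of `L` are those of `Z` at the unit. The transposition `bend`
finally translates squares back into the stated formulas. -/

noncomputable section

namespace BraidedFTC

attribute [local instance] Abelian.hasFiniteBiproducts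

/-! ### Projective generators of finite linear categories -/

section Generator

variable {k : Type w} [Field k] {C : Type u} [Category.{v} C] [Abelian C] [Linear k C]

/-- If every simple object is a quotient of the projective object `P`, then every artinian object
`X` with `Hom(P, X)` finite-dimensional is a quotient of a finite sum of copies of `P`. -/
lemma exists_epi_biproduct (k : Type w) [Field k] [Linear k C] (P : C) [Projective P]
    (hP : ∀ S : C, Simple S → ∃ p : P ⟶ S, p ≠ 0)
    (hart : ∀ X : C, IsArtinianObject X) (X : C) [Module.Finite k (P ⟶ X)] :
    ∃ (n : ℕ) (h : (⨁ fun _ : Fin n => P) ⟶ X), Epi h := by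
  let b := Module.finBasis k (P ⟶ X)
  refine ⟨_, biproduct.desc b, ?_⟩
  by_contra hepi
  have hK : ¬IsZero (cokernel (biproduct.desc b)) := fun h0 =>
    hepi (Preadditive.epi_of_cokernel_zero (h0.eq_of_tgt _ _))
  have := hart (cokernel (biproduct.desc b))
  -- A nonzero artinian cokernel contains a simple subobject, hence receives a nonzero map from `P`.
  -- Projectivity lifts this map to `P ⟶ X`, but all such maps are combinations of the basis and die
  -- in the cokernel.
  obtain ⟨p, hp⟩ := hP (simpleSubobject hK) inferInstance
  let p' : P ⟶ cokernel (biproduct.desc b) := p ≫ simpleSubobjectArrow hK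
  have hzero : ∀ g : P ⟶ X, g ≫ cokernel.π (biproduct.desc b) = 0 := by
    intro g
    rw [← b.sum_repr g, Preadditive.sum_comp]
    refine Finset.sum_eq_zero fun i _ => ?_
    rw [Linear.smul_comp, ← biproduct.ι_desc (fun i => b i) i, Category.assoc, cokernel.condition,
      comp_zero, smul_zero]
  have h1 := hzero (Projective.factorThru p' (cokernel.π _))
  rw [Projective.factorThru_comp] at h1
  exact hp (zero_of_comp_mono _ h1)

lemma projective_biproduct {n : ℕ} (g : Fin n → C) [∀ i, Projective (g i)] :
    Projective (⨁ g) where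
  factors f e := ⟨biproduct.desc fun b => Projective.factorThru (biproduct.ι g b ≫ f) e,
    biproduct.hom_ext' _ _ fun j => by simp⟩

/-- A finite linear category has a projective generator. -/
lemma exists_projective_generator (k : Type w) [Field k] [Linear k C]
    [IsFiniteLinearCategory k C] :
    ∃ P : C, Projective P ∧ ∀ X : C,
      ∃ (n : ℕ) (h : (⨁ fun _ : Fin n => P) ⟶ X), Epi h := by
  have := IsFiniteLinearCategory.enoughProjectives (k := k) (C := C)
  have hfin := IsFiniteLinearCategory.finite_hom (k := k) (C := C)
  have hart := IsFiniteLinearCategory.artinian (k := k) (C := C)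
  obtain ⟨n, S, hS⟩ := IsFiniteLinearCategory.finite_simples (k := k) (C := C)
  have hproj := projective_biproduct fun i => Projective.over (S i)
  refine ⟨⨁ fun i => Projective.over (S i), hproj, fun X => ?_⟩
  refine exists_epi_biproduct k _ (fun T hT => ?_) hart X
  obtain ⟨i, ⟨e⟩⟩ := hS T hT
  refine ⟨biproduct.π _ i ≫ Projective.π (S i) ≫ e.inv, fun h0 => ?_⟩
  exact Simple.not_isZero T (IsZero.of_epi_eq_zero _ h0)

end Generator

/-! ### Existence of coends -/

section CoendExistence

section

variable {C : Type u} [Category.{v} C]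

lemma exists_isColimit_cowedge_of_universal (F : Cᵒᵖ ⥤ C ⥤ C) (Q : C)
    (i : ∀ x : C, (F.obj (op x)).obj x ⟶ Q)
    (hi : ∀ ⦃x y : C⦄ (f : x ⟶ y), (F.map f.op).app x ≫ i x = (F.obj (op y)).map f ≫ i y)
    (hdesc : ∀ {T : C} (t : ∀ x : C, (F.obj (op x)).obj x ⟶ T),
      (∀ ⦃x y : C⦄ (f : x ⟶ y), (F.map f.op).app x ≫ t x = (F.obj (op y)).map f ≫ t y) →
        ∃ g : Q ⟶ T, ∀ x, i x ≫ g = t x)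
    (hext : ∀ {T : C} (s t : Q ⟶ T), (∀ x, i x ≫ s = i x ≫ t) → s = t) :
    ∃ c : Cowedge F, Nonempty (IsColimit c) := by
  have h := fun s : Cowedge F => hdesc (fun x => s.π x) (fun x y f => s.condition f)
  choose g hg using h
  exact ⟨Cowedge.mk Q i hi, ⟨Multicofork.IsColimit.mk _ g hg
    fun s m hm => hext _ _ fun x => (hm x).trans (hg s x).symm⟩⟩

end

variable {k : Type w} [Field k] {C : Type u} [Category.{v} C] [Abelian C] [Linear k C]

/-- A bifunctor `Cᵒᵖ ⥤ C ⥤ C` on a finite linear category has a coend, provided that it is linear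
in each variable and right exact in the covariant one. -/
lemma exists_isColimit_cowedge (k : Type w) [Field k] [Linear k C] [IsFiniteLinearCategory k C]
    (F : Cᵒᵖ ⥤ C ⥤ C) [∀ x, (F.obj x).Additive] [∀ x, (F.obj x).Linear k]
    [∀ x, PreservesFiniteColimits (F.obj x)]
    (hadd : ∀ {x y : C} (f g : x ⟶ y) (z : C), (F.map (f + g).op).app z =
      (F.map f.op).app z + (F.map g.op).app z)
    (hsmul : ∀ {x y : C} (a : k) (f : x ⟶ y) (z : C), (F.map (a • f).op).app z =
      a • (F.map f.op).app z) :
    ∃ c : Cowedge F, Nonempty (IsColimit c) := by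
  obtain ⟨P, hP, hgen⟩ := exists_projective_generator k (C := C)
  have hfin := IsFiniteLinearCategory.finite_hom (k := k) (C := C)
  have hsum : ∀ {x y : C} {J : Type} (s : Finset J) (f : J → (x ⟶ y)) (z : C),
      (F.map (∑ j ∈ s, f j).op).app z = ∑ j ∈ s, (F.map (f j).op).app z := fun s f z =>
    map_sum (AddMonoidHom.mk' (fun f : _ ⟶ _ => (F.map f.op).app z) fun f g => hadd f g z) f s
  let b := Module.finBasis k (P ⟶ P)
  let A : C := (F.obj (op P)).obj P
  let d : (P ⟶ P) → (A ⟶ A) := fun f => (F.map f.op).app P - (F.obj (op P)).map f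
  -- By linearity, the dinaturality relations for all endomorphisms of `P` follow from those for a
  -- basis, so a finite biproduct suffices.
  let R : (⨁ fun _ : Fin (Module.finrank k (P ⟶ P)) => A) ⟶ A := biproduct.desc fun j => d (b j)
  let Q : C := cokernel R
  let q : A ⟶ Q := cokernel.π R
  have hd : ∀ {T : C} (t : A ⟶ T), R ≫ t = 0 →
      ∀ f : P ⟶ P, (F.map f.op).app P ≫ t = (F.obj (op P)).map f ≫ t := by
    intro T t ht f
    have hj : ∀ j, (F.map (b j).op).app P ≫ t = (F.obj (op P)).map (b j) ≫ t := by
      intro j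
      rw [← sub_eq_zero, ← Preadditive.sub_comp]
      change d (b j) ≫ t = 0
      rw [← biproduct.ι_desc (fun j => d (b j)) j, Category.assoc, ht, comp_zero]
    rw [← b.sum_repr f, hsum, Functor.map_sum, Preadditive.sum_comp, Preadditive.sum_comp]
    refine Finset.sum_congr rfl fun j _ => ?_
    rw [hsmul, Functor.map_smul, Linear.smul_comp, Linear.smul_comp, hj]
  have hq := hd q (cokernel.condition R)
  -- morphisms out of `F(x, y)` are determined by their values on the generator
  have hext : ∀ (x : Cᵒᵖ) (y : C) {T : C} (s t : (F.obj x).obj y ⟶ T),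
      (∀ u : P ⟶ y, (F.obj x).map u ≫ s = (F.obj x).map u ≫ t) → s = t := by
    intro x y T s t hst
    obtain ⟨n, h, hh⟩ := hgen y
    rw [← cancel_epi ((F.obj x).map h)]
    have e : (F.obj x).map h = ∑ j, (F.obj x).map (biproduct.π (fun _ => P) j) ≫
        (F.obj x).map (biproduct.ι (fun _ => P) j ≫ h) := by
      simp only [← Functor.map_comp, ← Functor.map_sum, ← Category.assoc,
        ← Preadditive.sum_comp, biproduct.total, Category.id_comp]
    rw [e]
    simp only [Preadditive.sum_comp, Category.assoc]
    exact Finset.sum_congr rfl fun j _ => congrArg _ (hst _)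
  -- the component of the dinatural family at `x`
  have hi : ∀ x : C, ∃ i : (F.obj (op x)).obj x ⟶ Q,
      ∀ u : P ⟶ x, (F.obj (op x)).map u ≫ i = (F.map u.op).app P ≫ q := by
    intro x
    obtain ⟨n, h, hh⟩ := hgen x
    -- The value on the `j`-th copy of `P` is forced by dinaturality along `ι j ≫ h : P ⟶ x`.
    let φ : (F.obj (op x)).obj (⨁ fun _ : Fin n => P) ⟶ Q :=
      ∑ j, (F.obj (op x)).map (biproduct.π (fun _ => P) j) ≫
        (F.map (biproduct.ι (fun _ => P) j ≫ h).op).app P ≫ q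
    have hφ : ∀ u : P ⟶ ⨁ fun _ : Fin n => P,
        (F.obj (op x)).map u ≫ φ = (F.map (u ≫ h).op).app P ≫ q := by
      intro u
      have hu : u ≫ h = ∑ j, (u ≫ biproduct.π (fun _ => P) j) ≫
          (biproduct.ι (fun _ => P) j ≫ h) := by
        conv_lhs => rw [← Category.id_comp h, ← biproduct.total]
        simp only [Preadditive.sum_comp, Preadditive.comp_sum, Category.assoc]
      rw [hu, hsum, Preadditive.sum_comp, Preadditive.comp_sum]
      refine Finset.sum_congr rfl fun j _ => ?_
      -- Since `u ≫ π j` is an endomorphism of `P`, `hq` moves it from the contravariant to the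
      -- covariant variable.
      rw [op_comp (f := u ≫ _), Functor.map_comp, NatTrans.comp_app, Category.assoc, hq,
        ← Functor.map_comp_assoc, ← NatTrans.naturality_assoc]
    have hker : (F.obj (op x)).map (kernel.ι h) ≫ φ = 0 := by
      refine hext _ _ _ _ fun u => ?_
      rw [← Functor.map_comp_assoc, hφ, Category.assoc, kernel.condition, comp_zero, comp_zero]
      -- That `F` kills the zero morphism in the contravariant variable is the case `a = 0` of
      -- `hsmul`.
      have := hsmul (0 : k) (0 : P ⟶ x) P
      rw [zero_smul, zero_smul] at this
      rw [this, zero_comp]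
    -- The epimorphism `h` is the cokernel of its kernel, and right exactness of `F(x, -)` preserves
    -- this; hence `φ` descends to `F(x, x)`.
    have hcok : IsColimit (CokernelCofork.ofπ h (kernel.condition h)) :=
      Abelian.epiIsCokernelOfKernel (KernelFork.ofι _ (kernel.condition h)) (kernelIsKernel h)
    have hcok' := isColimitCoforkMapOfIsColimit' (F.obj (op x)) (kernel.condition h) hcok
    obtain ⟨i, hi⟩ := CokernelCofork.IsColimit.desc' hcok' φ hker
    refine ⟨i, fun u => ?_⟩
    rw [← Projective.factorThru_comp u h, ← hφ, ← hi, Functor.map_comp, Category.assoc]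
    rfl
  choose i hi using hi
  have hiP : i P = q := by
    have := hi P (𝟙 P)
    simpa using this
  refine exists_isColimit_cowedge_of_universal F Q i (fun x y f => ?_) (fun {T} t ht => ?_)
    (fun {T} s t hst => ?_)
  · refine hext _ _ _ _ fun u => ?_
    rw [NatTrans.naturality_assoc, hi, ← Functor.map_comp_assoc, hi, op_comp,
      Functor.map_comp, NatTrans.comp_app, Category.assoc]
  · have hfac : R ≫ t P = 0 := by
      refine biproduct.hom_ext' _ _ fun j => ?_
      rw [← Category.assoc, biproduct.ι_desc, comp_zero, Preadditive.sub_comp, sub_eq_zero]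
      exact ht (b j)
    refine ⟨cokernel.desc R (t P) hfac, fun x => hext _ _ _ _ fun u => ?_⟩
    rw [reassoc_of% hi x u, cokernel.π_desc, ht]
  · rw [← cancel_epi q, ← hiP, hst]

lemma rightAdjointMate_add [MonoidalCategory C] [MonoidalPreadditive C] [RightRigidCategory C]
    {x y : C} (f g : x ⟶ y) : (f + g)ᘁ = (fᘁ) + (gᘁ) := by
  simp [rightAdjointMate]

lemma rightAdjointMate_smul [MonoidalCategory C] [MonoidalPreadditive C] [MonoidalLinear k C]
    [RightRigidCategory C] (a : k) {x y : C} (f : x ⟶ y) : (a • f)ᘁ = a • (fᘁ) := by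
  simp [rightAdjointMate]

lemma nonempty_centralCoends (k : Type w) [Field k] [Linear k C] [MonoidalCategory C]
    [MonoidalPreadditive C] [MonoidalLinear k C] [RigidCategory C]
    [IsFiniteLinearCategory k C] : Nonempty (CentralCoends C) := by
  have h : ∀ c : C, ∃ w : Cowedge (centralBifunctor c), Nonempty (IsColimit w) := by
    intro c
    have (x : Cᵒᵖ) : ((centralBifunctor c).obj x).Additive :=
      inferInstanceAs (tensorLeft c ⋙ tensorLeft (x.unop)ᘁ).Additive
    have (x : Cᵒᵖ) : ((centralBifunctor c).obj x).Linear k :=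
      inferInstanceAs ((tensorLeft c ⋙ tensorLeft (x.unop)ᘁ).Linear k)
    -- The left dual provides a right adjoint of `x ⊗ -`. Left duals are needed only here.
    have (x : C) : PreservesFiniteColimits (tensorLeft x) :=
      have := (tensorLeftAdjunction (ᘁx) x).leftAdjoint_preservesColimits
      inferInstance
    have (x : Cᵒᵖ) : PreservesFiniteColimits ((centralBifunctor c).obj x) :=
      inferInstanceAs (PreservesFiniteColimits (tensorLeft c ⋙ tensorLeft (x.unop)ᘁ))
    refine exists_isColimit_cowedge k _ (fun f g z => ?_) (fun a f z => ?_)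
    · change ((f + g)ᘁ) ▷ (c ⊗ z) = (fᘁ) ▷ (c ⊗ z) + (gᘁ) ▷ (c ⊗ z)
      rw [rightAdjointMate_add, MonoidalPreadditive.add_whiskerRight]
    · change ((a • f)ᘁ) ▷ (c ⊗ z) = a • ((fᘁ) ▷ (c ⊗ z))
      rw [rightAdjointMate_smul, MonoidalLinear.smul_whiskerRight]
  choose w hw using h
  exact ⟨⟨w, fun c => (hw c).some⟩⟩

end CoendExistence

/-! ### Calculus of squares `c ⊗ x ⟶ x ⊗ d` -/

section Squares

variable {C : Type u} [Category.{v} C] [MonoidalCategory C]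

/-- Vertical pasting of squares `c ⊗ x ⟶ x ⊗ d` and `d ⊗ y ⟶ y ⊗ e`. -/
def vcomp {c d e x y : C} (p : c ⊗ x ⟶ x ⊗ d) (q : d ⊗ y ⟶ y ⊗ e) :
    c ⊗ (x ⊗ y) ⟶ (x ⊗ y) ⊗ e :=
  (α_ c x y).inv ≫ p ▷ y ≫ (α_ x d y).hom ≫ x ◁ q ≫ (α_ x y e).inv

/-- Horizontal pasting of squares `c ⊗ x ⟶ x ⊗ d` and `c' ⊗ x ⟶ x ⊗ d'`. -/
def hcomp {c d c' d' x : C} (p : c ⊗ x ⟶ x ⊗ d) (p' : c' ⊗ x ⟶ x ⊗ d') :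
    (c ⊗ c') ⊗ x ⟶ x ⊗ (d ⊗ d') :=
  (α_ c c' x).hom ≫ c ◁ p' ≫ (α_ c x d').inv ≫ p ▷ d' ≫ (α_ x d d').hom

/-- The square `𝟙 ⊗ x ⟶ x ⊗ 𝟙` given by the unitors. -/
def unitSquare (x : C) : 𝟙_ C ⊗ x ⟶ x ⊗ 𝟙_ C := (λ_ x).hom ≫ (ρ_ x).inv

/-- The value of a square `c ⊗ 𝟙 ⟶ 𝟙 ⊗ d`. -/
def unitValue {c d : C} (p : c ⊗ 𝟙_ C ⟶ 𝟙_ C ⊗ d) : c ⟶ d := (ρ_ c).inv ≫ p ≫ (λ_ d).hom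

lemma vcomp_comp_left {c d d' e x y : C} (p : c ⊗ x ⟶ x ⊗ d) (f : d ⟶ d')
    (q : d' ⊗ y ⟶ y ⊗ e) : vcomp (p ≫ x ◁ f) q = vcomp p (f ▷ y ≫ q) := by
  simp [vcomp]

lemma vcomp_comp_right {c d e e' x y : C} (p : c ⊗ x ⟶ x ⊗ d) (q : d ⊗ y ⟶ y ⊗ e) (f : e ⟶ e') :
    vcomp p (q ≫ y ◁ f) = vcomp p q ≫ (x ⊗ y) ◁ f := by
  simp [vcomp]

lemma whiskerRight_vcomp {c c' d e x y : C} (f : c ⟶ c') (p : c' ⊗ x ⟶ x ⊗ d)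
    (q : d ⊗ y ⟶ y ⊗ e) : vcomp (f ▷ x ≫ p) q = f ▷ (x ⊗ y) ≫ vcomp p q := by
  simp [vcomp]

lemma vcomp_assoc {c d e a x y z : C} (p : c ⊗ x ⟶ x ⊗ d) (q : d ⊗ y ⟶ y ⊗ e)
    (s : e ⊗ z ⟶ z ⊗ a) : vcomp (vcomp p q) s =
      c ◁ (α_ x y z).hom ≫ vcomp p (vcomp q s) ≫ (α_ x y z).inv ▷ a := by
  simp only [vcomp]
  monoidal

lemma hcomp_comp {c d e c' d' e' x : C} (p : c ⊗ x ⟶ x ⊗ d) (p' : c' ⊗ x ⟶ x ⊗ d')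
    (f : d ⟶ e) (f' : d' ⟶ e') :
    hcomp (p ≫ x ◁ f) (p' ≫ x ◁ f') = hcomp p p' ≫ x ◁ (f ⊗ₘ f') := by
  simp only [hcomp, tensorHom_def', MonoidalCategory.whiskerLeft_comp, comp_whiskerRight,
    Category.assoc]
  rw [associator_inv_naturality_right_assoc, whisker_exchange_assoc]
  simp

lemma whiskerRight_hcomp {a c d a' c' d' x : C} (f : a ⟶ c) (f' : a' ⟶ c')
    (p : c ⊗ x ⟶ x ⊗ d) (p' : c' ⊗ x ⟶ x ⊗ d') :
    hcomp (f ▷ x ≫ p) (f' ▷ x ≫ p') = (f ⊗ₘ f') ▷ x ≫ hcomp p p' := by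
  simp only [hcomp, tensorHom_def', MonoidalCategory.whiskerLeft_comp, comp_whiskerRight,
    Category.assoc]
  rw [associator_naturality_left_assoc, ← whisker_exchange_assoc]
  simp

lemma hcomp_assoc {c d c' d' c'' d'' x : C} (p : c ⊗ x ⟶ x ⊗ d) (p' : c' ⊗ x ⟶ x ⊗ d')
    (p'' : c'' ⊗ x ⟶ x ⊗ d'') :
    hcomp (hcomp p p') p'' ≫ x ◁ (α_ d d' d'').hom =
      (α_ c c' c'').hom ▷ x ≫ hcomp p (hcomp p' p'') := by
  simp only [hcomp]
  monoidal

/-- Interchange law: `p` and `q'` act on disjoint tensor factors and therefore commute. It is the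
source of the compatibility of multiplication and coproduct. -/
lemma hcomp_vcomp {c d e c' d' e' x y : C} (p : c ⊗ x ⟶ x ⊗ d) (q : d ⊗ y ⟶ y ⊗ e)
    (p' : c' ⊗ x ⟶ x ⊗ d') (q' : d' ⊗ y ⟶ y ⊗ e') :
    hcomp (vcomp p q) (vcomp p' q') = vcomp (hcomp p p') (hcomp q q') := by
  simp only [hcomp, vcomp]
  calc
    _ = 𝟙 _ ⊗≫ c ◁ p' ▷ y ⊗≫ ((c ⊗ x) ◁ q' ≫ p ▷ (y ⊗ e')) ⊗≫ x ◁ q ▷ e' ⊗≫ 𝟙 _ := by monoidal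
    _ = _ := by rw [whisker_exchange]; monoidal

lemma hcomp_unitSquare_left {c d x : C} (p : c ⊗ x ⟶ x ⊗ d) :
    hcomp (unitSquare x) p = (λ_ c).hom ▷ x ≫ p ≫ x ◁ (λ_ d).inv := by
  simp only [hcomp, unitSquare]
  monoidal

lemma hcomp_unitSquare_right {c d x : C} (p : c ⊗ x ⟶ x ⊗ d) :
    hcomp p (unitSquare x) = (ρ_ c).hom ▷ x ≫ p ≫ x ◁ (ρ_ d).inv := by
  simp only [hcomp, unitSquare]
  monoidal

lemma vcomp_unitSquare (x y : C) :
    vcomp (unitSquare x) (unitSquare y) = unitSquare (x ⊗ y) := by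
  simp only [vcomp, unitSquare]
  monoidal

lemma vcomp_unit_right {c d e x : C} (p : c ⊗ x ⟶ x ⊗ d) (q : d ⊗ 𝟙_ C ⟶ 𝟙_ C ⊗ e) :
    vcomp p q = c ◁ (ρ_ x).hom ≫ p ≫ x ◁ unitValue q ≫ (ρ_ x).inv ▷ e := by
  simp only [vcomp, unitValue]
  monoidal

lemma vcomp_unit_left {c d e x : C} (p : c ⊗ 𝟙_ C ⟶ 𝟙_ C ⊗ d) (q : d ⊗ x ⟶ x ⊗ e) :
    vcomp p q = c ◁ (λ_ x).hom ≫ unitValue p ▷ x ≫ q ≫ (λ_ x).inv ▷ e := by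
  simp only [vcomp, unitValue]
  monoidal

lemma unitValue_hcomp {c d c' d' : C} (p : c ⊗ 𝟙_ C ⟶ 𝟙_ C ⊗ d) (p' : c' ⊗ 𝟙_ C ⟶ 𝟙_ C ⊗ d') :
    unitValue (hcomp p p') = unitValue p ⊗ₘ unitValue p' := by
  simp only [hcomp, unitValue, tensorHom_def']
  monoidal

lemma unitValue_comp {c d e : C} (p : c ⊗ 𝟙_ C ⟶ 𝟙_ C ⊗ d) (f : d ⟶ e) :
    unitValue (p ≫ 𝟙_ C ◁ f) = unitValue p ≫ f := by
  simp [unitValue]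

lemma unitValue_unitSquare : unitValue (unitSquare (𝟙_ C)) = 𝟙 (𝟙_ C) := by
  simp only [unitValue, unitSquare]
  monoidal

lemma unitValue_whiskerRight_comp {c d e : C} (f : c ⟶ d) (p : d ⊗ 𝟙_ C ⟶ 𝟙_ C ⊗ e) :
    unitValue (f ▷ 𝟙_ C ≫ p) = f ≫ unitValue p := by
  simp [unitValue]

/-- A family of squares `c ⊗ X i ⟶ X i ⊗ d` is jointly epimorphic if it detects equality
of morphisms `d ⊗ v ⟶ e`. -/
def JointlyEpi {c d : C} {I : Type*} {X : I → C} (p : ∀ i, c ⊗ X i ⟶ X i ⊗ d) : Prop :=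
  ∀ ⦃v e : C⦄ (f g : d ⊗ v ⟶ e), (∀ i, p i ▷ v ≫ (α_ _ _ _).hom ≫ X i ◁ f =
    p i ▷ v ≫ (α_ _ _ _).hom ≫ X i ◁ g) → f = g

lemma JointlyEpi.hom_ext {c d : C} {I : Type*} {X : I → C} {p : ∀ i, c ⊗ X i ⟶ X i ⊗ d}
    (hp : JointlyEpi p) {e : C} {f g : d ⟶ e} (h : ∀ i, p i ≫ X i ◁ f = p i ≫ X i ◁ g) :
    f = g := by
  have := hp ((ρ_ d).hom ≫ f) ((ρ_ d).hom ≫ g) fun i => by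
    have e (k : d ⟶ e) : p i ▷ 𝟙_ C ≫ (α_ _ _ _).hom ≫ X i ◁ ((ρ_ d).hom ≫ k) =
      (ρ_ _).hom ≫ p i ≫ X i ◁ k := by simp
    rw [e, e, h]
  exact (cancel_epi _).1 this

/-- The spectator object in `JointlyEpi` makes the notion stable under pasting: `q` is tested with
spectator `v`, then `p` with spectator `Y j ⊗ v`. -/
lemma JointlyEpi.vcomp {c d e : C} {I J : Type*} {X : I → C} {Y : J → C}
    {p : ∀ i, c ⊗ X i ⟶ X i ⊗ d} {q : ∀ j, d ⊗ Y j ⟶ Y j ⊗ e} (hp : JointlyEpi p)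
    (hq : JointlyEpi q) :
    JointlyEpi (X := fun ij : I × J => X ij.1 ⊗ Y ij.2) fun ij => vcomp (p ij.1) (q ij.2) := by
  intro v a f g h
  refine hq _ _ fun j => ?_
  rw [← cancel_epi (α_ _ _ _).inv]
  refine hp _ _ fun i => ?_
  have key (k : e ⊗ v ⟶ a) : p i ▷ (Y j ⊗ v) ≫ (α_ _ _ _).hom ≫
      X i ◁ ((α_ _ _ _).inv ≫ q j ▷ v ≫ (α_ _ _ _).hom ≫ Y j ◁ k) =
      (α_ _ _ _).inv ≫ (α_ _ _ _).hom ▷ v ≫ (BraidedFTC.vcomp (p i) (q j) ▷ v ≫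
        (α_ _ _ _).hom ≫ (X i ⊗ Y j) ◁ k) ≫ (α_ _ _ _).hom := by
    simp only [BraidedFTC.vcomp]
    monoidal
  rw [key, key]
  congr 3
  exact h (i, j)

end Squares

/-! ### Squares from the braiding -/

section BraidedSquares

variable {C : Type u} [Category.{v} C] [MonoidalCategory C] [BraidedCategory C]

/-- The square `c ⊗ x ⟶ x ⊗ c` given by the inverse of the braiding `x ⊗ c ⟶ c ⊗ x`. -/
def braidSquare (c x : C) : c ⊗ x ⟶ x ⊗ c := (β_ x c).inv

lemma whiskerRight_braidSquare {c d : C} (f : c ⟶ d) (x : C) :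
    f ▷ x ≫ braidSquare d x = braidSquare c x ≫ x ◁ f :=
  BraidedCategory.braiding_inv_naturality_left f x

lemma whiskerLeft_braidSquare (c : C) {x y : C} (f : x ⟶ y) :
    c ◁ f ≫ braidSquare c y = braidSquare c x ≫ f ▷ c :=
  BraidedCategory.braiding_inv_naturality_right c f

/-- This and `braidSquare_hcomp` are the two hexagon identities. -/
lemma braidSquare_vcomp (c x y : C) :
    vcomp (braidSquare c x) (braidSquare c y) = braidSquare c (x ⊗ y) := by
  simp [vcomp, braidSquare]

lemma braidSquare_hcomp (c d x : C) :
    hcomp (braidSquare c x) (braidSquare d x) = braidSquare (c ⊗ d) x := by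
  simp [hcomp, braidSquare]

lemma braidSquare_unit (x : C) : braidSquare (𝟙_ C) x = unitSquare x := by
  simp [braidSquare, unitSquare]

lemma unitValue_braidSquare (c : C) : unitValue (braidSquare c (𝟙_ C)) = 𝟙 c := by
  simp [braidSquare, unitValue]

lemma JointlyEpi.hcomp_braidSquare {c d : C} {I : Type*} {X : I → C}
    {p : ∀ i, c ⊗ X i ⟶ X i ⊗ d} (hp : JointlyEpi p) (a : C) :
    JointlyEpi fun i => hcomp (p i) (braidSquare a (X i)) := by
  intro v e f g h
  rw [← cancel_epi (α_ _ _ _).inv]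
  refine hp _ _ fun i => ?_
  have key (k : (d ⊗ a) ⊗ v ⟶ e) : p i ▷ (a ⊗ v) ≫ (α_ _ _ _).hom ≫ X i ◁ ((α_ _ _ _).inv ≫ k) =
      𝟙 _ ⊗≫ c ◁ (β_ (X i) a).hom ▷ v ⊗≫ (hcomp (p i) (braidSquare a (X i)) ▷ v ≫
        (α_ _ _ _).hom ≫ X i ◁ k) := by
    calc
      _ = 𝟙 _ ⊗≫ c ◁ ((β_ (X i) a).hom ≫ (β_ (X i) a).inv) ▷ v ⊗≫ p i ▷ a ▷ v ⊗≫ X i ◁ k := by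
        rw [Iso.hom_inv_id]; monoidal
      _ = _ := by simp only [hcomp, braidSquare]; monoidal
  rw [key, key, h]

end BraidedSquares

/-! ### Transposition along duals -/

section Bending

variable {C : Type u} [Category.{v} C] [MonoidalCategory C]

/-- Transposition exchanges `f` and its mate `fᘁ`; this is what turns dinaturality of `D.i` into
naturality of `D.r`. -/
lemma tensorLeftHomEquiv_symm_comp_whiskerRight [RightRigidCategory C] {x y a d : C}
    (g : a ⟶ x ⊗ d) (f : x ⟶ y) :
    (tensorLeftHomEquiv a y yᘁ d).symm (g ≫ f ▷ d) =
      (fᘁ) ▷ a ≫ (tensorLeftHomEquiv a x xᘁ d).symm g := by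
  change yᘁ ◁ (g ≫ f ▷ d) ≫ (α_ _ _ _).inv ≫ ε_ y yᘁ ▷ d ≫ (λ_ d).hom =
    (fᘁ) ▷ a ≫ xᘁ ◁ g ≫ (α_ _ _ _).inv ≫ ε_ x xᘁ ▷ d ≫ (λ_ d).hom
  have h := congrArg (· ▷ d) (rightAdjointMate_comp_evaluation f)
  simp only [comp_whiskerRight] at h
  rw [← whisker_exchange_assoc, associator_inv_naturality_left_assoc, reassoc_of% h]
  simp

lemma tensorLeftHomEquiv_symm_comp_whiskerLeft {X Y Y' Z Z' : C} [ExactPairing Y Y']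
    (f : X ⟶ Y ⊗ Z) (g : Z ⟶ Z') :
    (tensorLeftHomEquiv X Y Y' Z').symm (f ≫ Y ◁ g) =
      (tensorLeftHomEquiv X Y Y' Z).symm f ≫ g := by
  rw [Equiv.symm_apply_eq, tensorLeftHomEquiv_naturality, Equiv.apply_symm_apply]

end Bending

/-! ### Universal property of the squares `D.r c x` -/

namespace CentralCoends

variable {C : Type u} [Category.{v} C] [MonoidalCategory C] [RightRigidCategory C]
  (D : CentralCoends C)

/-- The square `c ⊗ x ⟶ x ⊗ Z c` corresponding to the dinatural morphism `xᘁ ⊗ c ⊗ x ⟶ Z c`. -/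
def r (c x : C) : c ⊗ x ⟶ x ⊗ D.Z.obj c := tensorLeftHomEquiv (c ⊗ x) x xᘁ _ (D.i c x)

lemma symm_r (c x : C) : (tensorLeftHomEquiv (c ⊗ x) x xᘁ _).symm (D.r c x) = D.i c x :=
  Equiv.symm_apply_apply _ _

lemma i_map {c d : C} (f : c ⟶ d) (x : C) :
    D.i c x ≫ D.Z.map f = xᘁ ◁ (f ▷ x) ≫ D.i d x := D.ι_map f x

lemma whiskerRight_r {c d : C} (f : c ⟶ d) (x : C) :
    f ▷ x ≫ D.r d x = D.r c x ≫ x ◁ D.Z.map f := by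
  apply (tensorLeftHomEquiv _ x xᘁ _).symm.injective
  rw [tensorLeftHomEquiv_symm_naturality, tensorLeftHomEquiv_symm_comp_whiskerLeft, symm_r,
    symm_r, i_map]

lemma whiskerLeft_r (c : C) {x y : C} (f : x ⟶ y) :
    c ◁ f ≫ D.r c y = D.r c x ≫ f ▷ D.Z.obj c := by
  apply (tensorLeftHomEquiv _ y yᘁ _).symm.injective
  rw [tensorLeftHomEquiv_symm_naturality, tensorLeftHomEquiv_symm_comp_whiskerRight, symm_r,
    symm_r]
  exact (D.ι_dinatural c f).symm

lemma i_comp_eq_iff {c x d : C} (f : D.Z.obj c ⟶ d) (t : c ⊗ x ⟶ x ⊗ d) :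
    D.i c x ≫ f = (tensorLeftHomEquiv (c ⊗ x) x xᘁ d).symm t ↔ D.r c x ≫ x ◁ f = t := by
  rw [← (tensorLeftHomEquiv (c ⊗ x) x xᘁ d).symm.injective.eq_iff,
    tensorLeftHomEquiv_symm_comp_whiskerLeft, symm_r]

lemma exists_desc {c d : C} (t : ∀ x : C, c ⊗ x ⟶ x ⊗ d)
    (ht : ∀ ⦃x y : C⦄ (f : x ⟶ y), c ◁ f ≫ t y = t x ≫ f ▷ d) :
    ∃ f : D.Z.obj c ⟶ d, ∀ x, D.r c x ≫ x ◁ f = t x := by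
  refine ⟨Cowedge.IsColimit.desc (D.isColimit c)
    (fun x => (tensorLeftHomEquiv (c ⊗ x) x xᘁ d).symm (t x)) fun x y f => ?_, fun x => ?_⟩
  · refine (tensorLeftHomEquiv_symm_comp_whiskerRight _ _).symm.trans ?_
    rw [← ht, tensorLeftHomEquiv_symm_naturality]
    rfl
  · refine (D.i_comp_eq_iff _ _).1 ?_
    exact Cowedge.IsColimit.π_desc (D.isColimit c) _ _ x

/-- The functor `- ⊗ v` has the right adjoint `- ⊗ vᘁ`, so a family on `(c ⊗ x) ⊗ v` can be
transposed, factored through the coend and transposed back. Uniqueness of the factorization is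
`r_jointlyEpi`. -/
lemma exists_desc_tensor {c v d : C} (t : ∀ x : C, (c ⊗ x) ⊗ v ⟶ x ⊗ d)
    (ht : ∀ ⦃x y : C⦄ (f : x ⟶ y), (c ◁ f) ▷ v ≫ t y = t x ≫ f ▷ d) :
    ∃ f : D.Z.obj c ⊗ v ⟶ d, ∀ x, D.r c x ▷ v ≫ (α_ _ _ _).hom ≫ x ◁ f = t x := by
  obtain ⟨f, hf⟩ := D.exists_desc
    (fun x => tensorRightHomEquiv (c ⊗ x) v vᘁ (x ⊗ d) (t x) ≫ (α_ _ _ _).hom) fun x y f => by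
      rw [← cancel_mono (α_ _ _ _).inv]
      apply (tensorRightHomEquiv _ v vᘁ _).symm.injective
      have h := tensorRightHomEquiv_naturality (Y' := vᘁ) (t x) (f ▷ d)
      rw [← ht] at h
      have h' : (α_ x d vᘁ).hom ≫ f ▷ (d ⊗ vᘁ) ≫ (α_ y d vᘁ).inv = f ▷ d ▷ vᘁ := by simp
      rw [Category.assoc, Category.assoc, Category.assoc, Category.assoc, Iso.hom_inv_id,
        Category.comp_id, h', tensorRightHomEquiv_symm_naturality, ← h, Equiv.symm_apply_apply,
        Equiv.symm_apply_apply]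
  refine ⟨(tensorRightHomEquiv _ v vᘁ _).symm f, fun x => ?_⟩
  have h : D.r c x ▷ v ≫ (α_ _ _ _).hom ≫ x ◁ (tensorRightHomEquiv _ v vᘁ _).symm f =
      (tensorRightHomEquiv _ v vᘁ _).symm ((D.r c x ≫ x ◁ f) ≫ (α_ _ _ _).inv) := by
    simp only [tensorRightHomEquiv, Equiv.coe_fn_symm_mk]
    monoidal
  rw [h, hf]
  simp

lemma r_jointlyEpi (c : C) : JointlyEpi (D.r c) := by
  intro v e f g h
  apply (tensorRightHomEquiv _ v vᘁ _).injective
  refine D.hom_ext fun x => ?_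
  change D.i c x ≫ _ = D.i c x ≫ _
  rw [← (tensorLeftHomEquiv _ x xᘁ _).apply_eq_iff_eq, tensorLeftHomEquiv_naturality,
    tensorLeftHomEquiv_naturality]
  change D.r c x ≫ _ = D.r c x ≫ _
  have key (k : D.Z.obj c ⊗ v ⟶ e) : D.r c x ≫ x ◁ tensorRightHomEquiv _ v vᘁ _ k =
      tensorRightHomEquiv _ v vᘁ _ (D.r c x ▷ v ≫ (α_ _ _ _).hom ≫ x ◁ k) ≫ (α_ _ _ _).hom := by
    simp only [tensorRightHomEquiv, Equiv.coe_fn_mk]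
    calc
      _ = 𝟙 _ ⊗≫ (D.r c x ▷ 𝟙_ C ≫ (x ⊗ D.Z.obj c) ◁ η_ v vᘁ) ⊗≫ x ◁ k ▷ vᘁ ⊗≫ 𝟙 _ := by
        monoidal
      _ = _ := by rw [← whisker_exchange]; monoidal
  rw [key, key, h]

end CentralCoends

/-! ### The central bimonad -/

section

variable {C : Type u} [Category.{v} C] [MonoidalCategory C] [RightRigidCategory C]

/-- The defining formulas of the central bimonad, in terms of the squares `c ⊗ x ⟶ x ⊗ Z c`. -/
structure IsSquareBimonad (D : CentralCoends C) (B : BimonadStr D.Z) : Prop where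
  unit : ∀ c : C, B.e.app c = unitValue (D.r c (𝟙_ C))
  mul : ∀ c x y : C, vcomp (D.r c x) (D.r (D.Z.obj c) y) ≫ (x ⊗ y) ◁ B.m.app c = D.r c (x ⊗ y)
  counit : ∀ x : C, D.r (𝟙_ C) x ≫ x ◁ B.counit = unitSquare x
  comul : ∀ c d x : C, D.r (c ⊗ d) x ≫ x ◁ B.comul c d = hcomp (D.r c x) (D.r d x)

namespace CentralCoends

variable (D : CentralCoends C)

lemma vcomp_r_jointlyEpi (c : C) :
    JointlyEpi fun xy : C × C => vcomp (D.r c xy.1) (D.r (D.Z.obj c) xy.2) :=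
  (D.r_jointlyEpi c).vcomp (D.r_jointlyEpi _)

/-- A Fubini argument: the family `D.r c (x ⊗ y)` is factored first in `x` with `y` as spectator,
giving `Z c ⊗ y ⟶ y ⊗ Z c`, and this family, natural in `y`, is then factored again. -/
lemma exists_mul (c : C) : ∃ m : D.Z.obj (D.Z.obj c) ⟶ D.Z.obj c, ∀ x y : C,
    vcomp (D.r c x) (D.r (D.Z.obj c) y) ≫ (x ⊗ y) ◁ m = D.r c (x ⊗ y) := by
  have h (y : C) := D.exists_desc_tensor (v := y)
    (fun x => (α_ c x y).hom ≫ D.r c (x ⊗ y) ≫ (α_ _ _ _).hom) fun x x' f => by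
      rw [associator_naturality_middle_assoc]
      have := D.whiskerLeft_r c (f ▷ y)
      rw [reassoc_of% this]
      simp
  choose t ht using h
  obtain ⟨m, hm⟩ := D.exists_desc t fun y y' f => D.r_jointlyEpi c _ _ fun x => by
    have h1 : D.r c x ▷ y ≫ (α_ _ _ _).hom ≫ x ◁ (D.Z.obj c ◁ f ≫ t y') =
        (c ⊗ x) ◁ f ≫ D.r c x ▷ y' ≫ (α_ _ _ _).hom ≫ x ◁ t y' := by
      rw [whisker_exchange_assoc]
      simp
    have h2 : D.r c x ▷ y ≫ (α_ _ _ _).hom ≫ x ◁ (t y ≫ f ▷ D.Z.obj c) =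
        (D.r c x ▷ y ≫ (α_ _ _ _).hom ≫ x ◁ t y) ≫ x ◁ (f ▷ D.Z.obj c) := by
      simp
    have h3 := D.whiskerLeft_r c (x ◁ f)
    rw [h1, h2, ht, ht, associator_naturality_right_assoc, reassoc_of% h3]
    simp
  refine ⟨m, fun x y => ?_⟩
  have : vcomp (D.r c x) (D.r (D.Z.obj c) y) ≫ (x ⊗ y) ◁ m = (α_ _ _ _).inv ≫
      (D.r c x ▷ y ≫ (α_ _ _ _).hom ≫ x ◁ (D.r (D.Z.obj c) y ≫ y ◁ m)) ≫ (α_ _ _ _).inv := by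
    simp [vcomp]
  rw [this, hm, ht]
  simp

lemma exists_counit : ∃ e : D.Z.obj (𝟙_ C) ⟶ 𝟙_ C, ∀ x : C,
    D.r (𝟙_ C) x ≫ x ◁ e = unitSquare x :=
  D.exists_desc unitSquare fun x y f => by simp [unitSquare]

lemma exists_comul (c d : C) : ∃ t : D.Z.obj (c ⊗ d) ⟶ D.Z.obj c ⊗ D.Z.obj d, ∀ x : C,
    D.r (c ⊗ d) x ≫ x ◁ t = hcomp (D.r c x) (D.r d x) :=
  D.exists_desc (fun x => hcomp (D.r c x) (D.r d x)) fun x y f => by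
    have h1 := D.whiskerLeft_r d f
    have h2 := D.whiskerLeft_r c f
    simp only [hcomp]
    rw [associator_naturality_right_assoc, ← whiskerLeft_comp_assoc, h1]
    simp only [MonoidalCategory.whiskerLeft_comp, Category.assoc]
    rw [associator_inv_naturality_middle_assoc, ← comp_whiskerRight_assoc, h2]
    simp

/-- The multiplication `Z Z c ⟶ Z c`. -/
def mul (c : C) : D.Z.obj (D.Z.obj c) ⟶ D.Z.obj c := (D.exists_mul c).choose

lemma vcomp_r_mul (c x y : C) :
    vcomp (D.r c x) (D.r (D.Z.obj c) y) ≫ (x ⊗ y) ◁ D.mul c = D.r c (x ⊗ y) :=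
  (D.exists_mul c).choose_spec x y

/-- The counit `Z 𝟙 ⟶ 𝟙`. -/
def counit : D.Z.obj (𝟙_ C) ⟶ 𝟙_ C := D.exists_counit.choose

lemma r_counit (x : C) : D.r (𝟙_ C) x ≫ x ◁ D.counit = unitSquare x :=
  D.exists_counit.choose_spec x

/-- The coproduct `Z (c ⊗ d) ⟶ Z c ⊗ Z d`. -/
def comul (c d : C) : D.Z.obj (c ⊗ d) ⟶ D.Z.obj c ⊗ D.Z.obj d := (D.exists_comul c d).choose

lemma r_comul (c d x : C) : D.r (c ⊗ d) x ≫ x ◁ D.comul c d = hcomp (D.r c x) (D.r d x) :=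
  (D.exists_comul c d).choose_spec x

lemma r_map {c d : C} (f : c ⟶ d) (x : C) :
    D.r c x ≫ x ◁ D.Z.map f = f ▷ x ≫ D.r d x :=
  (D.whiskerRight_r f x).symm

lemma r_map_comul (x : C) : D.r (𝟙_ C) x ≫
    x ◁ (D.Z.map (λ_ (𝟙_ C)).inv ≫ D.comul (𝟙_ C) (𝟙_ C)) =
      (λ_ (𝟙_ C)).inv ▷ x ≫ hcomp (D.r (𝟙_ C) x) (D.r (𝟙_ C) x) := by
  rw [MonoidalCategory.whiskerLeft_comp, reassoc_of% D.r_map, r_comul]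

lemma mul_naturality {c d : C} (f : c ⟶ d) :
    D.Z.map (D.Z.map f) ≫ D.mul d = D.mul c ≫ D.Z.map f := by
  refine (D.vcomp_r_jointlyEpi c).hom_ext fun ⟨x, y⟩ => ?_
  simp only [MonoidalCategory.whiskerLeft_comp]
  rw [reassoc_of% D.vcomp_r_mul, r_map, ← reassoc_of% vcomp_comp_right, r_map,
    ← vcomp_comp_left, r_map, whiskerRight_vcomp, Category.assoc, vcomp_r_mul]

/-- Tested on triple pastings, both sides become `D.r c` at the tensor product of three objects, up
to an associator absorbed by naturality of `D.r`. -/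
lemma mul_assoc (c : C) : D.Z.map (D.mul c) ≫ D.mul c = D.mul (D.Z.obj c) ≫ D.mul c := by
  refine ((D.vcomp_r_jointlyEpi c).vcomp (D.r_jointlyEpi _)).hom_ext fun ⟨⟨x, y⟩, z⟩ => ?_
  simp only [MonoidalCategory.whiskerLeft_comp]
  have h := D.whiskerLeft_r c (α_ x y z).hom
  rw [← reassoc_of% vcomp_comp_right, r_map, ← vcomp_comp_left, vcomp_r_mul, vcomp_r_mul,
    vcomp_assoc, Category.assoc, Category.assoc, ← whisker_exchange_assoc,
    ← reassoc_of% vcomp_comp_right, vcomp_r_mul, ← whisker_exchange, reassoc_of% D.vcomp_r_mul,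
    reassoc_of% h]
  simp

/-- The defining identity of `D.mul` with `y = 𝟙_ C`; naturality along `ρ_ x` identifies `D.r c (x ⊗
𝟙_ C)` with `D.r c x`. The other unit law takes the first object to be `𝟙_ C`. -/
lemma unit_mul (c : C) : unitValue (D.r (D.Z.obj c) (𝟙_ C)) ≫ D.mul c = 𝟙 (D.Z.obj c) := by
  refine (D.r_jointlyEpi c).hom_ext fun x => ?_
  have h1 := D.vcomp_r_mul c x (𝟙_ C)
  have h2 := D.whiskerLeft_r c (ρ_ x).hom
  rw [vcomp_unit_right, Category.assoc, Category.assoc, Category.assoc, ← whisker_exchange,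
    ← cancel_mono ((ρ_ x).hom ▷ D.Z.obj c), ← h2] at h1
  simpa using h1

lemma map_unit_mul (c : C) : D.Z.map (unitValue (D.r c (𝟙_ C))) ≫ D.mul c = 𝟙 (D.Z.obj c) := by
  refine (D.r_jointlyEpi c).hom_ext fun x => ?_
  have h1 := D.vcomp_r_mul c (𝟙_ C) x
  have h2 := D.whiskerLeft_r c (λ_ x).hom
  rw [vcomp_unit_left, Category.assoc, Category.assoc, Category.assoc, ← whisker_exchange,
    ← cancel_mono ((λ_ x).hom ▷ D.Z.obj c), ← h2] at h1
  rw [MonoidalCategory.whiskerLeft_comp, reassoc_of% D.r_map]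
  refine (cancel_epi (c ◁ (λ_ x).hom)).1 ?_
  simpa using h1

/-- The comonoidal structure on `Z`. -/
abbrev oplax : D.Z.OplaxMonoidal where
  η := D.counit
  δ := D.comul
  δ_natural_left f c := by
    refine (D.r_jointlyEpi _).hom_ext fun x => ?_
    have h := hcomp_comp (D.r _ x) (D.r c x) (D.Z.map f) (𝟙 _)
    have h' := whiskerRight_hcomp f (𝟙 c) (D.r _ x) (D.r c x)
    simp only [whiskerLeft_id, id_whiskerRight, Category.comp_id, Category.id_comp,
      tensorHom_id] at h h'
    rw [MonoidalCategory.whiskerLeft_comp, MonoidalCategory.whiskerLeft_comp,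
      reassoc_of% D.r_comul, reassoc_of% D.r_map, r_comul, ← h, ← h', r_map]
  δ_natural_right c f := by
    refine (D.r_jointlyEpi _).hom_ext fun x => ?_
    have h := hcomp_comp (D.r c x) (D.r _ x) (𝟙 _) (D.Z.map f)
    have h' := whiskerRight_hcomp (𝟙 c) f (D.r c x) (D.r _ x)
    simp only [whiskerLeft_id, id_whiskerRight, Category.comp_id, Category.id_comp,
      id_tensorHom] at h h'
    rw [MonoidalCategory.whiskerLeft_comp, MonoidalCategory.whiskerLeft_comp,
      reassoc_of% D.r_comul, reassoc_of% D.r_map, r_comul, ← h, ← h', r_map]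
  oplax_associativity c d e := by
    refine (D.r_jointlyEpi _).hom_ext fun x => ?_
    have h := hcomp_comp (D.r (c ⊗ d) x) (D.r e x) (D.comul c d) (𝟙 _)
    have h' := hcomp_comp (D.r c x) (D.r (d ⊗ e) x) (𝟙 _) (D.comul d e)
    simp only [whiskerLeft_id, Category.comp_id, tensorHom_id, id_tensorHom] at h h'
    simp only [MonoidalCategory.whiskerLeft_comp]
    rw [reassoc_of% D.r_comul, reassoc_of% D.r_map, reassoc_of% D.r_comul, ← h', ← reassoc_of% h,
      r_comul, r_comul, hcomp_assoc]
  oplax_left_unitality c := by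
    refine (D.r_jointlyEpi _).hom_ext fun x => ?_
    have h := hcomp_comp (D.r (𝟙_ C) x) (D.r c x) D.counit (𝟙 _)
    simp only [whiskerLeft_id, Category.comp_id, tensorHom_id] at h
    simp only [MonoidalCategory.whiskerLeft_comp]
    rw [reassoc_of% D.r_map, reassoc_of% D.r_comul, ← h, r_counit, hcomp_unitSquare_left]
    simp
  oplax_right_unitality c := by
    refine (D.r_jointlyEpi _).hom_ext fun x => ?_
    have h := hcomp_comp (D.r c x) (D.r (𝟙_ C) x) (𝟙 _) D.counit
    simp only [whiskerLeft_id, Category.comp_id, id_tensorHom] at h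
    simp only [MonoidalCategory.whiskerLeft_comp]
    rw [reassoc_of% D.r_map, reassoc_of% D.r_comul, ← h, r_counit, hcomp_unitSquare_right]
    simp

/-- The central bimonad. -/
def bimonad : BimonadStr D.Z where
  e :=
    { app := fun c => unitValue (D.r c (𝟙_ C))
      naturality := fun c d f => by
        change f ≫ unitValue (D.r d (𝟙_ C)) = unitValue (D.r c (𝟙_ C)) ≫ D.Z.map f
        rw [← unitValue_comp, r_map, unitValue_whiskerRight_comp] }
  m :=
    { app := D.mul
      naturality := fun c d f => D.mul_naturality f }
  assoc := D.mul_assoc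
  left_unit := D.unit_mul
  right_unit := D.map_unit_mul
  oplax := D.oplax
  e_counit := by
    change unitValue (D.r (𝟙_ C) (𝟙_ C)) ≫ D.counit = 𝟙 _
    rw [← unitValue_comp, r_counit, unitValue_unitSquare]
  e_comul c d := by
    change unitValue (D.r _ (𝟙_ C)) ≫ D.comul c d = _ ⊗ₘ _
    rw [← unitValue_comp, r_comul, unitValue_hcomp]
  m_counit := by
    change D.mul (𝟙_ C) ≫ D.counit = D.Z.map D.counit ≫ D.counit
    refine (D.vcomp_r_jointlyEpi _).hom_ext fun ⟨x, y⟩ => ?_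
    simp only [MonoidalCategory.whiskerLeft_comp]
    rw [reassoc_of% D.vcomp_r_mul, r_counit, ← reassoc_of% vcomp_comp_right, r_map,
      ← vcomp_comp_left, r_counit, ← vcomp_comp_right, r_counit, vcomp_unitSquare]
  m_comul c d := by
    change D.mul (c ⊗ d) ≫ D.comul c d = D.Z.map (D.comul c d) ≫
      D.comul (D.Z.obj c) (D.Z.obj d) ≫ (D.mul c ⊗ₘ D.mul d)
    refine (D.vcomp_r_jointlyEpi _).hom_ext fun ⟨x, y⟩ => ?_
    simp only [MonoidalCategory.whiskerLeft_comp]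
    -- Both sides reduce to pastings of four squares, in the two orders related by `hcomp_vcomp`.
    rw [reassoc_of% D.vcomp_r_mul, r_comul, ← reassoc_of% vcomp_comp_right, r_map,
      ← vcomp_comp_left, r_comul, ← reassoc_of% vcomp_comp_right, r_comul, ← hcomp_vcomp,
      ← hcomp_comp, vcomp_r_mul, vcomp_r_mul]

lemma bimonad_isSquareBimonad : IsSquareBimonad D D.bimonad where
  unit _ := rfl
  mul := D.vcomp_r_mul
  counit := D.r_counit
  comul := D.r_comul

variable {D} in
lemma _root_.BraidedFTC.IsSquareBimonad.eq {A B : BimonadStr D.Z} (hA : IsSquareBimonad D A)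
    (hB : IsSquareBimonad D B) : A = B := by
  have he : A.e = B.e := by
    ext c
    rw [hA.unit, hB.unit]
  have hm : A.m = B.m := by
    ext c
    refine (D.vcomp_r_jointlyEpi c).hom_ext fun ⟨x, y⟩ => ?_
    exact (hA.mul c x y).trans (hB.mul c x y).symm
  refine BimonadStr.ext he hm (Functor.OplaxMonoidal.ext ?_ ?_)
  · exact (D.r_jointlyEpi _).hom_ext fun x => (hA.counit x).trans (hB.counit x).symm
  · ext c d
    exact (D.r_jointlyEpi _).hom_ext fun x => (hA.comul c d x).trans (hB.comul c d x).symm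

end CentralCoends

end

/-! ### Inverses of bimonad isomorphisms -/

section

variable {C : Type u} [Category.{v} C] [MonoidalCategory C]

/-- The inverse of an isomorphism of bimonads is a morphism of bimonads. -/
lemma IsBimonadHom.inv {S T : C ⥤ C} {A : BimonadStr S} {B : BimonadStr T} {f : S ⟶ T}
    (hf : IsBimonadHom A B f) {g : T ⟶ S} (hfg : f ≫ g = 𝟙 S) (hgf : g ≫ f = 𝟙 T) :
    IsBimonadHom B A g := by
  have h1 (X : C) : f.app X ≫ g.app X = 𝟙 _ := by rw [← NatTrans.comp_app, hfg]; rfl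
  have h2 (X : C) : g.app X ≫ f.app X = 𝟙 _ := by rw [← NatTrans.comp_app, hgf]; rfl
  have hepi (X : C) : Epi (f.app X) := ⟨fun a b h => by
    rw [← Category.id_comp a, ← h2, Category.assoc, h, ← Category.assoc, h2, Category.id_comp]⟩
  have hmono (X : C) : Mono (f.app X) := ⟨fun a b h => by
    rw [← Category.comp_id a, ← h1, ← Category.assoc, h, Category.assoc, h1, Category.comp_id]⟩
  refine ⟨fun X => ?_, fun X => ?_, ?_, fun X Y => ?_⟩
  · rw [← hf.unit, Category.assoc, h1, Category.comp_id]
  · rw [← cancel_mono (f.app X), Category.assoc, h2, Category.comp_id, Category.assoc,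
      Category.assoc, hf.mul, ← NatTrans.naturality_assoc,
      ← Functor.map_comp_assoc, h2, CategoryTheory.Functor.map_id, Category.id_comp, reassoc_of% h2]
  · rw [← hf.counit, reassoc_of% h2]
  · rw [← cancel_epi (f.app (X ⊗ Y)), reassoc_of% h1, reassoc_of% hf.comul,
      tensorHom_comp_tensorHom, h1, h1, id_tensorHom_id, Category.comp_id]

end

/-! ### Exchanging squares past braidings -/

section

variable {C : Type u} [Category.{v} C] [MonoidalCategory C] [BraidedCategory C]

/-- The braiding is natural with respect to squares. -/
lemma hcomp_braidSquare_braiding {c d x : C} (p : c ⊗ x ⟶ x ⊗ d) (e : C) :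
    hcomp p (braidSquare e x) ≫ x ◁ (β_ d e).hom =
      (β_ c e).hom ▷ x ≫ hcomp (braidSquare e x) p := by
  have h := BraidedCategory.braiding_naturality_left p e
  rw [BraidedCategory.braiding_tensor_left_hom, BraidedCategory.braiding_tensor_left_hom] at h
  -- Naturality of the braiding at `p`, expanded by the hexagons and with the crossing of `x` and
  -- `e` moved to the other side.
  have h' : p ▷ e ≫ (α_ x d e).hom ≫ x ◁ (β_ d e).hom =
      (α_ c x e).hom ≫ c ◁ (β_ x e).hom ≫ (α_ c e x).inv ≫ (β_ c e).hom ▷ x ≫ (α_ e c x).hom ≫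
        e ◁ p ≫ (α_ e x d).inv ≫ (β_ x e).inv ▷ d ≫ (α_ x e d).hom := by
    rw [← cancel_mono ((α_ x e d).inv ≫ (β_ x e).hom ▷ d ≫ (α_ e x d).hom)]
    simpa [← comp_whiskerRight_assoc] using h
  simp only [hcomp, braidSquare, Category.assoc]
  rw [h']
  simp [← whiskerLeft_comp_assoc]

/-- A braiding of the two middle squares. -/
lemma hcomp_hcomp_tensorμ {c d c' d' a b x : C} (p : c ⊗ x ⟶ x ⊗ d) (p' : c' ⊗ x ⟶ x ⊗ d')
    (q : b ⊗ x ⟶ x ⊗ b) (hq : q = braidSquare b x) (q' : a ⊗ x ⟶ x ⊗ a) :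
    hcomp (hcomp p p') (hcomp q q') ≫ x ◁ tensorμ d d' b a =
      tensorμ c c' b a ▷ x ≫ hcomp (hcomp p q) (hcomp p' q') := by
  subst hq
  have h1 := hcomp_assoc p p' (hcomp (braidSquare b x) q')
  have h2 := hcomp_assoc p' (braidSquare b x) q'
  have h3 := hcomp_assoc (braidSquare b x) p' q'
  have h4 := hcomp_assoc p (braidSquare b x) (hcomp p' q')
  have hb := hcomp_braidSquare_braiding p' b
  have w {s t s' : C} (f : s ⟶ t) (u : s' ⊗ x ⟶ x ⊗ s) :
      hcomp p u ≫ x ◁ (d ◁ f) = hcomp p (u ≫ x ◁ f) := by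
    simpa using (hcomp_comp p u (𝟙 _) f).symm
  have w' {s t s' : C} (f : s' ⟶ s) (u : s ⊗ x ⟶ x ⊗ t) :
      hcomp p (f ▷ x ≫ u) = (c ◁ f) ▷ x ≫ hcomp p u := by
    simpa using whiskerRight_hcomp (𝟙 c) f p u
  have v {s t s' : C} (f : s ⟶ t) (u : s' ⊗ x ⟶ x ⊗ s) :
      hcomp u q' ≫ x ◁ (f ▷ a) = hcomp (u ≫ x ◁ f) q' := by
    simpa using (hcomp_comp u q' f (𝟙 _)).symm
  have v' {s t s' : C} (f : s' ⟶ s) (u : s ⊗ x ⟶ x ⊗ t) :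
      hcomp (f ▷ x ≫ u) q' = (f ▷ a) ▷ x ≫ hcomp u q' := by
    simpa using whiskerRight_hcomp f (𝟙 a) u q'
  have h2' : hcomp p' (hcomp (braidSquare b x) q') ≫ x ◁ (α_ d' b a).inv =
      (α_ c' b a).inv ▷ x ≫ hcomp (hcomp p' (braidSquare b x)) q' := by
    rw [← cancel_mono (x ◁ (α_ d' b a).hom), ← cancel_epi ((α_ c' b a).hom ▷ x)]
    simpa [← whiskerLeft_comp] using h2.symm
  have h4' : hcomp p (hcomp (braidSquare b x) (hcomp p' q')) ≫ x ◁ (α_ d b (d' ⊗ a)).inv =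
      (α_ c b (c' ⊗ a)).inv ▷ x ≫ hcomp (hcomp p (braidSquare b x)) (hcomp p' q') := by
    rw [← cancel_mono (x ◁ (α_ d b (d' ⊗ a)).hom), ← cancel_epi ((α_ c b (c' ⊗ a)).hom ▷ x)]
    simpa [← whiskerLeft_comp] using h4.symm
  simp only [tensorμ, MonoidalCategory.whiskerLeft_comp, comp_whiskerRight, Category.assoc]
  -- Reassociate until `p'` and the braiding square are adjacent, exchange them by `hb`, and
  -- reassociate back.
  rw [reassoc_of% h1, reassoc_of% w, h2', w', Category.assoc, reassoc_of% w, v, hb, v', w',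
    Category.assoc, reassoc_of% w, h3, w', Category.assoc, h4']

end

/-! ### The strength of `Z` and the isomorphism `ζ` -/

namespace CentralCoends

variable {C : Type u} [Category.{v} C] [MonoidalCategory C] [RightRigidCategory C]
  [BraidedCategory C] (D : CentralCoends C)

/-- Precomposing `D.r (d ⊗ c) x` with the braiding of `x` and `c` gives a natural family on `(d ⊗ x)
⊗ c`, which factors with spectator `c`; the braiding then cancels against `braidSquare`. -/
lemma exists_strength (d c : C) : ∃ s : D.Z.obj d ⊗ c ⟶ D.Z.obj (d ⊗ c), ∀ x : C,
    hcomp (D.r d x) (braidSquare c x) ≫ x ◁ s = D.r (d ⊗ c) x := by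
  obtain ⟨s, hs⟩ := D.exists_desc_tensor (c := d) (v := c)
    (fun x => (α_ _ _ _).hom ≫ d ◁ (β_ x c).hom ≫ (α_ _ _ _).inv ≫ D.r (d ⊗ c) x)
    fun x y f => by
      have h := D.whiskerLeft_r (d ⊗ c) f
      simp only [Category.assoc]
      rw [← h, associator_naturality_middle_assoc, ← whiskerLeft_comp_assoc,
        BraidedCategory.braiding_naturality_left]
      simp
  refine ⟨s, fun x => ?_⟩
  simp only [hcomp, Category.assoc]
  rw [hs]
  simp [braidSquare, ← whiskerLeft_comp_assoc]

lemma exists_strengthInv (d c : C) : ∃ s : D.Z.obj (d ⊗ c) ⟶ D.Z.obj d ⊗ c, ∀ x : C,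
    D.r (d ⊗ c) x ≫ x ◁ s = hcomp (D.r d x) (braidSquare c x) :=
  D.exists_desc _ fun x y f => by
    have h := D.whiskerLeft_r d f
    simp only [hcomp, Category.assoc]
    rw [associator_naturality_right_assoc, ← whiskerLeft_comp_assoc, whiskerLeft_braidSquare,
      whiskerLeft_comp_assoc, associator_inv_naturality_middle_assoc, ← comp_whiskerRight_assoc, h,
      comp_whiskerRight_assoc, associator_naturality_left]

/-- The strength `Z d ⊗ c ⟶ Z (d ⊗ c)` given by the braiding. -/
def strength (d c : C) : D.Z.obj d ⊗ c ≅ D.Z.obj (d ⊗ c) where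
  hom := (D.exists_strength d c).choose
  inv := (D.exists_strengthInv d c).choose
  hom_inv_id := ((D.r_jointlyEpi d).hcomp_braidSquare c).hom_ext fun x => by
    rw [MonoidalCategory.whiskerLeft_comp, reassoc_of% (D.exists_strength d c).choose_spec x,
      (D.exists_strengthInv d c).choose_spec x]
    simp
  inv_hom_id := (D.r_jointlyEpi _).hom_ext fun x => by
    rw [MonoidalCategory.whiskerLeft_comp, reassoc_of% (D.exists_strengthInv d c).choose_spec x,
      (D.exists_strength d c).choose_spec x]
    simp

lemma hcomp_strength (d c x : C) :
    hcomp (D.r d x) (braidSquare c x) ≫ x ◁ (D.strength d c).hom = D.r (d ⊗ c) x :=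
  (D.exists_strength d c).choose_spec x

lemma strength_naturality_right (d : C) {c c' : C} (f : c ⟶ c') :
    D.Z.obj d ◁ f ≫ (D.strength d c').hom = (D.strength d c).hom ≫ D.Z.map (d ◁ f) := by
  refine ((D.r_jointlyEpi d).hcomp_braidSquare c).hom_ext fun x => ?_
  have h := hcomp_comp (D.r d x) (braidSquare c x) (𝟙 _) f
  have h' := whiskerRight_hcomp (𝟙 _) f (D.r d x) (braidSquare c' x)
  simp only [whiskerLeft_id, id_whiskerRight, Category.comp_id, Category.id_comp,
    id_tensorHom] at h h'
  rw [MonoidalCategory.whiskerLeft_comp, MonoidalCategory.whiskerLeft_comp,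
    reassoc_of% D.hcomp_strength, r_map, ← reassoc_of% h, ← whiskerRight_braidSquare,
    reassoc_of% h', hcomp_strength]

/-- One hexagon splits the braiding square at `x ⊗ y` into two, and interchange distributes them
over the two squares `D.r`. -/
lemma mul_strength (d c : C) : D.mul d ▷ c ≫ (D.strength d c).hom =
    (D.strength (D.Z.obj d) c).hom ≫ D.Z.map (D.strength d c).hom ≫ D.mul (d ⊗ c) := by
  refine ((D.vcomp_r_jointlyEpi d).hcomp_braidSquare c).hom_ext fun ⟨x, y⟩ => ?_
  have h := hcomp_comp (vcomp (D.r d x) (D.r _ y)) (braidSquare c (x ⊗ y)) (D.mul d) (𝟙 _)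
  simp only [whiskerLeft_id, Category.comp_id, tensorHom_id] at h
  simp only [MonoidalCategory.whiskerLeft_comp]
  rw [← reassoc_of% h, vcomp_r_mul, hcomp_strength, ← braidSquare_vcomp, hcomp_vcomp,
    ← reassoc_of% vcomp_comp_right, hcomp_strength, ← reassoc_of% vcomp_comp_right, r_map,
    ← vcomp_comp_left, hcomp_strength, vcomp_r_mul]

lemma strength_tensor (d c c' : C) :
    (D.strength d c).hom ▷ c' ≫ (D.strength (d ⊗ c) c').hom =
      (α_ _ _ _).hom ≫ (D.strength d (c ⊗ c')).hom ≫ D.Z.map (α_ d c c').inv := by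
  refine (((D.r_jointlyEpi d).hcomp_braidSquare c).hcomp_braidSquare c').hom_ext fun x => ?_
  have h := hcomp_comp (hcomp (D.r d x) (braidSquare c x)) (braidSquare c' x)
    (D.strength d c).hom (𝟙 _)
  simp only [whiskerLeft_id, Category.comp_id, tensorHom_id] at h
  simp only [MonoidalCategory.whiskerLeft_comp]
  rw [← reassoc_of% h, hcomp_strength, hcomp_strength, reassoc_of% hcomp_assoc, braidSquare_hcomp,
    reassoc_of% D.hcomp_strength, r_map, ← comp_whiskerRight_assoc, Iso.hom_inv_id,
    id_whiskerRight, Category.id_comp]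

lemma unit_strength (d c : C) : unitValue (D.r d (𝟙_ C)) ▷ c ≫ (D.strength d c).hom =
    unitValue (D.r (d ⊗ c) (𝟙_ C)) := by
  rw [← D.hcomp_strength, unitValue_comp, unitValue_hcomp, unitValue_braidSquare, tensorHom_id]

/-- The isomorphism `L ⊗ c ⟶ Z c`. -/
def zeta (c : C) : D.Z.obj (𝟙_ C) ⊗ c ≅ D.Z.obj c :=
  D.strength (𝟙_ C) c ≪≫ D.Z.mapIso (λ_ c)

lemma hcomp_zeta (c x : C) :
    hcomp (D.r (𝟙_ C) x) (braidSquare c x) ≫ x ◁ (D.zeta c).hom =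
      (λ_ c).hom ▷ x ≫ D.r c x := by
  rw [zeta, Iso.trans_hom, MonoidalCategory.whiskerLeft_comp, reassoc_of% D.hcomp_strength]
  exact D.r_map _ x

lemma r_zeta_inv (c x : C) :
    D.r c x ≫ x ◁ (D.zeta c).inv =
      (λ_ c).inv ▷ x ≫ hcomp (D.r (𝟙_ C) x) (braidSquare c x) := by
  rw [← cancel_mono (x ◁ (D.zeta c).hom), Category.assoc, Category.assoc, hcomp_zeta,
    ← MonoidalCategory.whiskerLeft_comp, Iso.inv_hom_id, ← comp_whiskerRight_assoc,
    Iso.inv_hom_id]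
  simp

lemma zeta_naturality {c d : C} (f : c ⟶ d) :
    D.Z.obj (𝟙_ C) ◁ f ≫ (D.zeta d).hom = (D.zeta c).hom ≫ D.Z.map f := by
  simp only [zeta, Iso.trans_hom, Functor.mapIso_hom, Category.assoc]
  rw [reassoc_of% D.strength_naturality_right, ← Functor.map_comp, ← Functor.map_comp,
    leftUnitor_naturality]

lemma zeta_unit (c : C) : unitValue (D.r (𝟙_ C) (𝟙_ C)) ▷ c ≫ (D.zeta c).hom =
    (λ_ c).hom ≫ unitValue (D.r c (𝟙_ C)) := by
  simp only [zeta, Iso.trans_hom, Functor.mapIso_hom]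
  rw [reassoc_of% D.unit_strength, ← unitValue_comp, r_map, unitValue_whiskerRight_comp]

lemma zeta_tensorUnit : (D.zeta (𝟙_ C)).hom = (ρ_ _).hom := by
  refine ((D.r_jointlyEpi _).hcomp_braidSquare _).hom_ext fun x => ?_
  rw [hcomp_zeta, braidSquare_unit, hcomp_unitSquare_right, unitors_equal]
  simp

lemma strength_zeta (c d : C) : (D.zeta c).hom ▷ d ≫ (D.strength c d).hom =
    (α_ _ _ _).hom ≫ (D.zeta (c ⊗ d)).hom := by
  have h : (D.zeta c).hom ▷ d ≫ (D.strength c d).hom = (D.strength (𝟙_ C) c).hom ▷ d ≫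
      (D.strength (𝟙_ C ⊗ c) d).hom ≫ D.Z.map ((λ_ c).hom ▷ d) := by
    -- Naturality of the strength in its first variable, along `λ_ c`.
    have h := ((D.r_jointlyEpi (𝟙_ C ⊗ c)).hcomp_braidSquare d).hom_ext
      (f := D.Z.map (λ_ c).hom ▷ d ≫ (D.strength c d).hom)
      (g := (D.strength (𝟙_ C ⊗ c) d).hom ≫ D.Z.map ((λ_ c).hom ▷ d)) fun x => by
        have h := hcomp_comp (D.r _ x) (braidSquare d x) (D.Z.map (λ_ c).hom) (𝟙 _)
        have h' := whiskerRight_hcomp (λ_ c).hom (𝟙 d) (D.r _ x) (braidSquare d x)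
        simp only [whiskerLeft_id, id_whiskerRight, Category.comp_id, Category.id_comp,
          tensorHom_id] at h h'
        rw [MonoidalCategory.whiskerLeft_comp, MonoidalCategory.whiskerLeft_comp,
          reassoc_of% D.hcomp_strength, r_map, ← reassoc_of% h, r_map, reassoc_of% h',
          hcomp_strength]
    simp only [zeta, Iso.trans_hom, Functor.mapIso_hom, comp_whiskerRight, Category.assoc, h]
  rw [h, reassoc_of% D.strength_tensor, zeta, Iso.trans_hom, Functor.mapIso_hom,
    ← Functor.map_comp, leftUnitor_tensor_hom]

/-- With `mulL = ζ_L ≫ m_𝟙` this says that `ζ` respects multiplication; it combines `mul_strength`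
with naturality of `ζ`. -/
lemma zeta_mul (c : C) :
    ((D.zeta (D.Z.obj (𝟙_ C))).hom ≫ D.mul (𝟙_ C)) ▷ c ≫ (D.zeta c).hom =
      (α_ _ _ _).hom ≫ D.Z.obj (𝟙_ C) ◁ (D.zeta c).hom ≫ (D.zeta (D.Z.obj c)).hom ≫
        D.mul c := by
  have h : D.mul (𝟙_ C) ▷ c ≫ (D.zeta c).hom = (D.strength (D.Z.obj (𝟙_ C)) c).hom ≫
      D.Z.map (D.zeta c).hom ≫ D.mul c := by
    simp only [zeta, Iso.trans_hom, Functor.mapIso_hom, Functor.map_comp, Category.assoc]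
    rw [reassoc_of% D.mul_strength, mul_naturality]
  rw [comp_whiskerRight, Category.assoc, h, reassoc_of% D.strength_zeta,
    reassoc_of% D.zeta_naturality]

/-- On squares, `tensorμ` exchanges the second copy of `D.r (𝟙_ C) x` with the braiding square of
`c`, which leaves the horizontal pasting of the two families defining `ζ`. -/
lemma zeta_comul (c d : C) : (D.zeta (c ⊗ d)).hom ≫ D.comul c d =
    (D.Z.map (λ_ (𝟙_ C)).inv ≫ D.comul (𝟙_ C) (𝟙_ C)) ▷ (c ⊗ d) ≫ tensorμ _ _ _ _ ≫
      ((D.zeta c).hom ⊗ₘ (D.zeta d).hom) := by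
  refine ((D.r_jointlyEpi _).hcomp_braidSquare _).hom_ext fun x => ?_
  have h := hcomp_comp (D.r (𝟙_ C) x) (braidSquare (c ⊗ d) x)
    (D.Z.map (λ_ (𝟙_ C)).inv ≫ D.comul (𝟙_ C) (𝟙_ C)) (𝟙 _)
  have h' := whiskerRight_hcomp (λ_ (𝟙_ C)).inv (𝟙 (c ⊗ d))
    (hcomp (D.r (𝟙_ C) x) (D.r (𝟙_ C) x)) (braidSquare (c ⊗ d) x)
  simp only [whiskerLeft_id, id_whiskerRight, Category.comp_id, Category.id_comp,
    tensorHom_id] at h h'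
  have h2 := tensor_left_unitality c d
  rw [MonoidalCategory.whiskerLeft_comp, MonoidalCategory.whiskerLeft_comp,
    MonoidalCategory.whiskerLeft_comp, reassoc_of% D.hcomp_zeta, r_comul, ← reassoc_of% h,
    r_map_comul, h', Category.assoc, ← braidSquare_hcomp,
    reassoc_of% hcomp_hcomp_tensorμ _ _ _ rfl, ← hcomp_comp, hcomp_zeta, hcomp_zeta,
    whiskerRight_hcomp, h2]
  simp

end CentralCoends

/-! ### The bialgebra `L` -/

section

lemma bimonObj_ext {C : Type u} [Category.{v} C] [MonoidalCategory C] [BraidedCategory C] {X : C}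
    {H H' : BimonObj X} (h1 : H.one = H'.one) (h2 : H.mul = H'.mul)
    (h3 : H.counit = H'.counit) (h4 : H.comul = H'.comul) : H = H' := by
  obtain @⟨⟨one, mul⟩, ⟨counit, comul⟩⟩ := H
  obtain @⟨⟨one', mul'⟩, ⟨counit', comul'⟩⟩ := H'
  change one = one' at h1
  change mul = mul' at h2
  change counit = counit' at h3
  change comul = comul' at h4
  subst h1 h2 h3 h4
  rfl

end

namespace CentralCoends

variable {C : Type u} [Category.{v} C] [MonoidalCategory C] [RightRigidCategory C]
  (D : CentralCoends C)

/-- The unit of `L`. -/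
def oneL : 𝟙_ C ⟶ D.Z.obj (𝟙_ C) := unitValue (D.r (𝟙_ C) (𝟙_ C))

/-- The comultiplication of `L`. -/
def comulL : D.Z.obj (𝟙_ C) ⟶ D.Z.obj (𝟙_ C) ⊗ D.Z.obj (𝟙_ C) :=
  D.Z.map (λ_ (𝟙_ C)).inv ≫ D.comul (𝟙_ C) (𝟙_ C)

/-- The counit of `L`. -/
def counitL : D.Z.obj (𝟙_ C) ⟶ 𝟙_ C := D.counit

lemma oneL_comulL : D.oneL ≫ D.comulL = (λ_ (𝟙_ C)).inv ≫ (D.oneL ⊗ₘ D.oneL) := by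
  change unitValue _ ≫ _ ≫ _ = _
  rw [← reassoc_of% unitValue_comp, r_map, unitValue_whiskerRight_comp, Category.assoc,
    ← unitValue_comp, r_comul, unitValue_hcomp]
  rfl

lemma oneL_counitL : D.oneL ≫ D.counitL = 𝟙 (𝟙_ C) := D.bimonad.e_counit

lemma comulL_counitL_left : D.comulL ≫ D.counitL ▷ D.Z.obj (𝟙_ C) = (λ_ (D.Z.obj (𝟙_ C))).inv :=
  (Category.assoc _ _ _).trans (D.oplax.oplax_left_unitality (𝟙_ C)).symm

lemma comulL_counitL_right : D.comulL ≫ D.Z.obj (𝟙_ C) ◁ D.counitL = (ρ_ (D.Z.obj (𝟙_ C))).inv := by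
  have h := D.oplax.oplax_right_unitality (𝟙_ C)
  rw [← unitors_inv_equal] at h
  exact (Category.assoc _ _ _).trans h.symm

/-- Coassociativity of the comonoidal structure at three copies of `𝟙_ C`, with the unitors moved
inside `Z` by naturality of the coproduct. -/
lemma comulL_assoc : D.comulL ≫ D.Z.obj (𝟙_ C) ◁ D.comulL =
    D.comulL ≫ D.comulL ▷ D.Z.obj (𝟙_ C) ≫ (α_ _ _ _).hom := by
  have h1 := D.oplax.δ_natural_left (λ_ (𝟙_ C)).inv (𝟙_ C)
  have h2 := D.oplax.δ_natural_right (𝟙_ C) (λ_ (𝟙_ C)).inv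
  have h3 := D.oplax.oplax_associativity (𝟙_ C) (𝟙_ C) (𝟙_ C)
  change D.comul _ _ ≫ _ = _ ≫ D.comul _ _ at h1
  change D.comul _ _ ≫ _ = _ ≫ D.comul _ _ at h2
  change D.comul _ _ ≫ D.comul _ _ ▷ _ ≫ _ = _ ≫ D.comul _ _ ≫ _ ◁ D.comul _ _ at h3
  change (D.Z.map (λ_ (𝟙_ C)).inv ≫ D.comul (𝟙_ C) (𝟙_ C)) ≫ D.Z.obj (𝟙_ C) ◁
      (D.Z.map (λ_ (𝟙_ C)).inv ≫ D.comul (𝟙_ C) (𝟙_ C)) =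
    (D.Z.map (λ_ (𝟙_ C)).inv ≫ D.comul (𝟙_ C) (𝟙_ C)) ≫
      (D.Z.map (λ_ (𝟙_ C)).inv ≫ D.comul (𝟙_ C) (𝟙_ C)) ▷ D.Z.obj (𝟙_ C) ≫ (α_ _ _ _).hom
  simp only [MonoidalCategory.whiskerLeft_comp, comp_whiskerRight, Category.assoc]
  rw [reassoc_of% h1, reassoc_of% h2, h3, ← Functor.map_comp_assoc, ← Functor.map_comp_assoc,
    ← Functor.map_comp_assoc]
  congr 2
  monoidal

end CentralCoends

section

variable {C : Type u} [Category.{v} C] [MonoidalCategory C] [RightRigidCategory C]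
  [BraidedCategory C]

open scoped MonObj ComonObj in
/-- The defining formulas of the bialgebra `L`, in terms of the squares `𝟙 ⊗ x ⟶ x ⊗ L`. -/
structure IsSquareBialgebra (D : CentralCoends C) (H : BimonObj (D.Z.obj (𝟙_ C))) : Prop where
  one : η[D.Z.obj (𝟙_ C)] = unitValue (D.r (𝟙_ C) (𝟙_ C))
  mul : ∀ x y : C, vcomp (D.r (𝟙_ C) y)
    ((λ_ (D.Z.obj (𝟙_ C))).inv ▷ x ≫ hcomp (D.r (𝟙_ C) x) (braidSquare (D.Z.obj (𝟙_ C)) x)) ≫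
      (y ⊗ x) ◁ μ[D.Z.obj (𝟙_ C)] =
      D.r (𝟙_ C) (y ⊗ x)
  counit : ∀ x : C, D.r (𝟙_ C) x ≫ x ◁ ε[D.Z.obj (𝟙_ C)] = unitSquare x
  comul : ∀ x : C, D.r (𝟙_ C) x ≫ x ◁ Δ[D.Z.obj (𝟙_ C)] =
    (λ_ (𝟙_ C)).inv ▷ x ≫ hcomp (D.r (𝟙_ C) x) (D.r (𝟙_ C) x)

namespace CentralCoends

variable (D : CentralCoends C)

/-- Shows that the defining formula for `μ` prescribes `ζ_L⁻¹ ≫ μ` on the family that determines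
`D.mul (𝟙_ C)`. -/
lemma vcomp_r_zeta_inv (x y : C) :
    vcomp (D.r (𝟙_ C) y) ((λ_ (D.Z.obj (𝟙_ C))).inv ▷ x ≫
        hcomp (D.r (𝟙_ C) x) (braidSquare (D.Z.obj (𝟙_ C)) x)) =
      vcomp (D.r (𝟙_ C) y) (D.r (D.Z.obj (𝟙_ C)) x) ≫
        (y ⊗ x) ◁ (D.zeta (D.Z.obj (𝟙_ C))).inv := by
  rw [← vcomp_comp_right, r_zeta_inv]

/-- The multiplication of `L`. -/
def mulL : D.Z.obj (𝟙_ C) ⊗ D.Z.obj (𝟙_ C) ⟶ D.Z.obj (𝟙_ C) :=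
  (D.zeta (D.Z.obj (𝟙_ C))).hom ≫ D.mul (𝟙_ C)

lemma oneL_whiskerRight_zeta (c : C) : D.oneL ▷ c ≫ (D.zeta c).hom =
    (λ_ c).hom ≫ D.bimonad.e.app c := D.zeta_unit c

lemma mulL_whiskerRight_zeta (c : C) : D.mulL ▷ c ≫ (D.zeta c).hom =
    (α_ _ _ _).hom ≫ D.Z.obj (𝟙_ C) ◁ (D.zeta c).hom ≫ (D.zeta (D.Z.obj c)).hom ≫ D.mul c :=
  D.zeta_mul c

lemma whiskerLeft_zeta {c d : C} (f : c ⟶ d) :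
    D.Z.obj (𝟙_ C) ◁ f ≫ (D.zeta d).hom = (D.zeta c).hom ≫ D.Z.map f := D.zeta_naturality f

lemma zeta_comulL (c d : C) : (D.zeta (c ⊗ d)).hom ≫ D.comul c d =
    D.comulL ▷ (c ⊗ d) ≫ tensorμ _ _ _ _ ≫ ((D.zeta c).hom ⊗ₘ (D.zeta d).hom) :=
  D.zeta_comul c d

lemma oneL_mulL : D.oneL ▷ D.Z.obj (𝟙_ C) ≫ D.mulL = (λ_ (D.Z.obj (𝟙_ C))).hom := by
  have h1 := D.oneL_whiskerRight_zeta (D.Z.obj (𝟙_ C))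
  have h2 := D.unit_mul (𝟙_ C)
  change D.oneL ▷ D.Z.obj (𝟙_ C) ≫ (D.zeta (D.Z.obj (𝟙_ C))).hom ≫ D.mul (𝟙_ C) = _
  rw [reassoc_of% h1]
  exact (congrArg ((λ_ (D.Z.obj (𝟙_ C))).hom ≫ ·) h2).trans (Category.comp_id _)

lemma mulL_oneL : D.Z.obj (𝟙_ C) ◁ D.oneL ≫ D.mulL = (ρ_ (D.Z.obj (𝟙_ C))).hom := by
  have h1 := D.whiskerLeft_zeta D.oneL
  change D.Z.obj (𝟙_ C) ◁ D.oneL ≫ (D.zeta (D.Z.obj (𝟙_ C))).hom ≫ D.mul (𝟙_ C) = _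
  rw [reassoc_of% h1, zeta_tensorUnit]
  exact (congrArg ((ρ_ (D.Z.obj (𝟙_ C))).hom ≫ ·) (D.map_unit_mul (𝟙_ C))).trans
    (Category.comp_id _)

lemma mulL_assoc : D.mulL ▷ D.Z.obj (𝟙_ C) ≫ D.mulL =
    (α_ _ _ _).hom ≫ D.Z.obj (𝟙_ C) ◁ D.mulL ≫ D.mulL := by
  have h1 := D.mulL_whiskerRight_zeta (D.Z.obj (𝟙_ C))
  have h2 := D.whiskerLeft_zeta (D.mul (𝟙_ C))
  have h3 := D.mul_assoc (𝟙_ C)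
  change D.mulL ▷ D.Z.obj (𝟙_ C) ≫ (D.zeta (D.Z.obj (𝟙_ C))).hom ≫ D.mul (𝟙_ C) = (α_ _ _ _).hom ≫
    D.Z.obj (𝟙_ C) ◁ ((D.zeta (D.Z.obj (𝟙_ C))).hom ≫ D.mul (𝟙_ C)) ≫
      (D.zeta (D.Z.obj (𝟙_ C))).hom ≫ D.mul (𝟙_ C)
  rw [reassoc_of% h1, MonoidalCategory.whiskerLeft_comp, Category.assoc]
  rw [reassoc_of% h2, h3]

lemma mulL_counitL : D.mulL ≫ D.counitL = (D.counitL ⊗ₘ D.counitL) ≫ (λ_ (𝟙_ C)).hom := by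
  have h1 : D.mul (𝟙_ C) ≫ D.counit = D.Z.map D.counit ≫ D.counit := D.bimonad.m_counit
  have h2 := D.whiskerLeft_zeta D.counitL
  change ((D.zeta (D.Z.obj (𝟙_ C))).hom ≫ D.mul (𝟙_ C)) ≫ D.counit = _
  change _ = D.Z.map D.counitL ≫ D.counitL at h1
  rw [Category.assoc, h1, ← reassoc_of% h2, zeta_tensorUnit, ← rightUnitor_naturality,
    tensorHom_def', Category.assoc, unitors_equal]

/-- `zeta_comulL` at `(L, L)` trades `tensorμ` for the coproduct of `Z`; what remains is the bimonad
axiom at `(𝟙_ C, 𝟙_ C)`. -/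
lemma mulL_comulL : D.mulL ≫ D.comulL =
    (D.comulL ⊗ₘ D.comulL) ≫ tensorμ _ _ _ _ ≫ (D.mulL ⊗ₘ D.mulL) := by
  have h1 : D.mul (𝟙_ C ⊗ 𝟙_ C) ≫ D.comul (𝟙_ C) (𝟙_ C) = D.Z.map (D.comul (𝟙_ C) (𝟙_ C)) ≫
      D.comul (D.Z.obj (𝟙_ C)) (D.Z.obj (𝟙_ C)) ≫ (D.mul (𝟙_ C) ⊗ₘ D.mul (𝟙_ C)) :=
    D.bimonad.m_comul _ _
  have h2 := D.whiskerLeft_zeta D.comulL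
  have h3 := D.zeta_comulL (D.Z.obj (𝟙_ C)) (D.Z.obj (𝟙_ C))
  have h4 := D.mul_naturality (λ_ (𝟙_ C)).inv
  have h5 : D.Z.map D.comulL = D.Z.map (D.Z.map (λ_ (𝟙_ C)).inv) ≫
    D.Z.map (D.comul (𝟙_ C) (𝟙_ C)) := D.Z.map_comp _ _
  change ((D.zeta (D.Z.obj (𝟙_ C))).hom ≫ D.mul (𝟙_ C)) ≫ D.Z.map (λ_ (𝟙_ C)).inv ≫
    D.comul (𝟙_ C) (𝟙_ C) = _ ≫ _ ≫
      (((D.zeta (D.Z.obj (𝟙_ C))).hom ≫ D.mul (𝟙_ C)) ⊗ₘ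
        ((D.zeta (D.Z.obj (𝟙_ C))).hom ≫ D.mul (𝟙_ C)))
  rw [tensorHom_def', Category.assoc, Category.assoc, ← tensorHom_comp_tensorHom,
    ← reassoc_of% h3, reassoc_of% h2, h5, Category.assoc, ← reassoc_of% h4, h1]

/-- The bialgebra `L`. -/
abbrev bialgebra : BimonObj (D.Z.obj (𝟙_ C)) where
  one := D.oneL
  mul := D.mulL
  one_mul := D.oneL_mulL
  mul_one := D.mulL_oneL
  mul_assoc := D.mulL_assoc
  counit := D.counitL
  comul := D.comulL
  counit_comul := D.comulL_counitL_left
  comul_counit := D.comulL_counitL_right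
  comul_assoc := D.comulL_assoc
  mul_comul := D.mulL_comulL
  one_comul := D.oneL_comulL
  mul_counit := D.mulL_counitL
  one_counit := D.oneL_counitL

lemma bialgebra_isSquareBialgebra : IsSquareBialgebra D D.bialgebra where
  one := rfl
  mul x y := by
    rw [vcomp_r_zeta_inv, Category.assoc]
    change _ ≫ _ ≫ _ ◁ ((D.zeta (D.Z.obj (𝟙_ C))).hom ≫ D.mul (𝟙_ C)) = _
    rw [← MonoidalCategory.whiskerLeft_comp, Iso.inv_hom_id_assoc, vcomp_r_mul]
  counit := D.r_counit
  comul := D.r_map_comul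

end CentralCoends

open scoped MonObj ComonObj

variable {D : CentralCoends C}

namespace IsSquareBialgebra

lemma mul_eq {H : BimonObj (D.Z.obj (𝟙_ C))} (hH : IsSquareBialgebra D H) :
    μ[D.Z.obj (𝟙_ C)] = D.mulL := by
  have h : (D.zeta (D.Z.obj (𝟙_ C))).inv ≫ μ[D.Z.obj (𝟙_ C)] = D.mul (𝟙_ C) := by
    refine (D.vcomp_r_jointlyEpi (𝟙_ C)).hom_ext fun ⟨y, x⟩ => ?_
    have := hH.mul x y
    rw [D.vcomp_r_zeta_inv, Category.assoc, ← MonoidalCategory.whiskerLeft_comp] at this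
    rw [D.vcomp_r_mul]
    exact this
  exact (Iso.inv_comp_eq _).1 h

lemma counit_eq {H : BimonObj (D.Z.obj (𝟙_ C))} (hH : IsSquareBialgebra D H) :
    ε[D.Z.obj (𝟙_ C)] = D.counitL :=
  (D.r_jointlyEpi (𝟙_ C)).hom_ext fun x => (hH.counit x).trans (D.r_counit x).symm

lemma comul_eq {H : BimonObj (D.Z.obj (𝟙_ C))} (hH : IsSquareBialgebra D H) :
    Δ[D.Z.obj (𝟙_ C)] = D.comulL :=
  (D.r_jointlyEpi (𝟙_ C)).hom_ext fun x => (hH.comul x).trans (D.r_map_comul x).symm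

lemma eq {H H' : BimonObj (D.Z.obj (𝟙_ C))} (hH : IsSquareBialgebra D H)
    (hH' : IsSquareBialgebra D H') :
    H = H' := by
  have h1 := hH.one.trans hH'.one.symm
  have h2 := hH.mul_eq.trans hH'.mul_eq.symm
  have h3 := hH.counit_eq.trans hH'.counit_eq.symm
  have h4 := hH.comul_eq.trans hH'.comul_eq.symm
  exact bimonObj_ext h1 h2 h3 h4

end IsSquareBialgebra

namespace CentralCoends

variable (D) in
/-- The natural isomorphism `L ⊗ - ≅ Z`. -/
def zetaIso : tensorLeft (D.Z.obj (𝟙_ C)) ≅ D.Z :=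
  NatIso.ofComponents (fun c => D.zeta c) fun f => D.whiskerLeft_zeta f

lemma zetaIso_isBimonadHom {B : BimonadStr D.Z} {H : BimonObj (D.Z.obj (𝟙_ C))}
    (hB : IsSquareBimonad D B) (hH : IsSquareBialgebra D H) :
    IsBimonadHom (tensorBimonad (D.Z.obj (𝟙_ C))) B D.zetaIso.hom := by
  obtain rfl := hB.eq D.bimonad_isSquareBimonad
  obtain rfl := hH.eq D.bialgebra_isSquareBialgebra
  refine ⟨fun c => ?_, fun c => ?_, ?_, fun c d => ?_⟩
  · change ((λ_ c).inv ≫ D.oneL ▷ c) ≫ (D.zeta c).hom = _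
    rw [Category.assoc, oneL_whiskerRight_zeta, Iso.inv_hom_id_assoc]
  · change ((α_ (D.Z.obj (𝟙_ C)) (D.Z.obj (𝟙_ C)) c).inv ≫ D.mulL ▷ c) ≫ (D.zeta c).hom =
      D.Z.obj (𝟙_ C) ◁ (D.zeta c).hom ≫ (D.zeta (D.Z.obj c)).hom ≫ D.mul c
    rw [Category.assoc, mulL_whiskerRight_zeta, Iso.inv_hom_id_assoc]
  · change (D.zeta (𝟙_ C)).hom ≫ D.counit = (ρ_ (D.Z.obj (𝟙_ C))).hom ≫ D.counit
    rw [zeta_tensorUnit]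
  · change (D.zeta (c ⊗ d)).hom ≫ D.comul c d =
      (D.comulL ▷ (c ⊗ d) ≫ tensorμ (D.Z.obj (𝟙_ C)) (D.Z.obj (𝟙_ C)) c d) ≫
        ((D.zeta c).hom ⊗ₘ (D.zeta d).hom)
    rw [zeta_comulL, Category.assoc]

end CentralCoends

end

/-! ### Transposing pastings into formulas with duals -/

section DualComparison

variable {C : Type u} [Category.{v} C] [MonoidalCategory C]

lemma rightDualIso_hom_evaluation {X Y₁ Y₂ : C} (p₁ : ExactPairing X Y₁)
    (p₂ : ExactPairing X Y₂) :
    (rightDualIso p₁ p₂).hom ▷ X ≫ p₂.evaluation = p₁.evaluation := by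
  have := @rightAdjointMate_comp_evaluation C _ _ X X ⟨Y₂⟩ ⟨Y₁⟩ (𝟙 X)
  rw [whiskerLeft_id, Category.id_comp] at this
  exact this

/-- Transposes depend on the chosen dual only through the canonical isomorphism, because that
isomorphism respects evaluations. This absorbs `unitDual` and `tensorDual`. -/
lemma rightDualIso_hom_comp_symm {X Y₁ Y₂ a d : C} (p₁ : ExactPairing X Y₁)
    (p₂ : ExactPairing X Y₂) (t : a ⟶ X ⊗ d) :
    (rightDualIso p₁ p₂).hom ▷ a ≫ (@tensorLeftHomEquiv C _ _ a X Y₂ d p₂).symm t =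
      (@tensorLeftHomEquiv C _ _ a X Y₁ d p₁).symm t := by
  change _ ≫ Y₂ ◁ t ≫ (α_ _ _ _).inv ≫ p₂.evaluation ▷ d ≫ (λ_ d).hom =
    Y₁ ◁ t ≫ (α_ _ _ _).inv ≫ p₁.evaluation ▷ d ≫ (λ_ d).hom
  rw [← whisker_exchange_assoc, associator_inv_naturality_left_assoc,
    ← comp_whiskerRight_assoc, rightDualIso_hom_evaluation]

variable [RightRigidCategory C]

/-- The transpose of a square `c ⊗ x ⟶ x ⊗ d`. -/
def bend {c d x : C} (p : c ⊗ x ⟶ x ⊗ d) : xᘁ ⊗ (c ⊗ x) ⟶ d :=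
  (tensorLeftHomEquiv (c ⊗ x) x xᘁ d).symm p

/-- The transpose of a square `c ⊗ (x ⊗ y) ⟶ (x ⊗ y) ⊗ d` with respect to the dual `yᘁ ⊗ xᘁ`. -/
def bendTensor {c d x y : C} (p : c ⊗ (x ⊗ y) ⟶ (x ⊗ y) ⊗ d) :
    (yᘁ ⊗ xᘁ) ⊗ (c ⊗ (x ⊗ y)) ⟶ d :=
  (@tensorLeftHomEquiv C _ _ (c ⊗ (x ⊗ y)) (x ⊗ y) (yᘁ ⊗ xᘁ) d ExactPairing.tensor).symm p

lemma bend_eq {c d x : C} (p : c ⊗ x ⟶ x ⊗ d) :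
    bend p = (xᘁ : C) ◁ p ≫ (α_ _ _ _).inv ≫ ε_ x xᘁ ▷ d ≫ (λ_ d).hom := rfl

lemma bend_injective {c d x : C} : Function.Injective (bend (c := c) (d := d) (x := x)) :=
  Equiv.injective _

lemma bendTensor_eq {c d x y : C} (p : c ⊗ (x ⊗ y) ⟶ (x ⊗ y) ⊗ d) :
    bendTensor p = (yᘁ ⊗ xᘁ) ◁ p ≫ (α_ _ _ _).inv ≫
      (𝟙 _ ⊗≫ (yᘁ : C) ◁ (ε_ x xᘁ ▷ y) ⊗≫ ε_ y yᘁ) ▷ d ≫ (λ_ d).hom := rfl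

lemma bendTensor_injective {c d x y : C} :
    Function.Injective (bendTensor (c := c) (d := d) (x := x) (y := y)) :=
  Equiv.injective _

lemma bend_comp {c d e x : C} (p : c ⊗ x ⟶ x ⊗ d) (f : d ⟶ e) :
    bend (p ≫ x ◁ f) = bend p ≫ f :=
  tensorLeftHomEquiv_symm_comp_whiskerLeft _ _

lemma bendTensor_comp {c d e x y : C} (p : c ⊗ (x ⊗ y) ⟶ (x ⊗ y) ⊗ d) (f : d ⟶ e) :
    bendTensor (p ≫ (x ⊗ y) ◁ f) = bendTensor p ≫ f :=
  @tensorLeftHomEquiv_symm_comp_whiskerLeft C _ _ _ _ _ _ _ ExactPairing.tensor _ _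

lemma eq_bend {c d x : C} (p : c ⊗ x ⟶ x ⊗ d) :
    p = (λ_ _).inv ≫ η_ x xᘁ ▷ _ ≫ (α_ _ _ _).hom ≫ x ◁ bend p :=
  (Equiv.apply_symm_apply (tensorLeftHomEquiv (c ⊗ x) x xᘁ d) p).symm

lemma tensorDual_comp_bend {c d x y : C} (p : c ⊗ (x ⊗ y) ⟶ (x ⊗ y) ⊗ d) :
    (tensorDual x y).hom ▷ (c ⊗ (x ⊗ y)) ≫ bend p = bendTensor p :=
  rightDualIso_hom_comp_symm _ _ _

lemma unitDual_comp_bend {c d : C} (p : c ⊗ 𝟙_ C ⟶ 𝟙_ C ⊗ d) :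
    (𝟙 c ⊗≫ (unitDual C).hom ▷ (c ⊗ 𝟙_ C)) ≫ bend p = unitValue p := by
  have h := rightDualIso_hom_comp_symm exactPairingUnit
    (RightRigidCategory.rightDual (𝟙_ C)).exact p
  calc
    _ = 𝟙 c ⊗≫ ((unitDual C).hom ▷ (c ⊗ 𝟙_ C) ≫ bend p) := by monoidal
    _ = 𝟙 c ⊗≫ 𝟙_ C ◁ p ≫ (α_ _ _ _).inv ≫ (ρ_ _).hom ▷ d ≫ (λ_ d).hom :=
      congrArg (fun t => 𝟙 c ⊗≫ t) h
    _ = _ := by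
      rw [unitValue]
      monoidal

lemma bend_bend {c d e x y : C} (p : c ⊗ x ⟶ x ⊗ d) (q : d ⊗ y ⟶ y ⊗ e) :
    (yᘁ : C) ◁ (bend p ▷ y) ≫ bend q = 𝟙 _ ⊗≫ bendTensor (vcomp p q) := by
  rw [bend_eq, bend_eq, bendTensor_eq, vcomp]
  calc
    _ = 𝟙 _ ⊗≫ (yᘁ : C) ◁ (xᘁ : C) ◁ p ▷ y ⊗≫ (yᘁ : C) ◁ (ε_ x xᘁ ▷ (d ⊗ y) ≫ 𝟙_ C ◁ q) ⊗≫
        ε_ y yᘁ ▷ e ⊗≫ 𝟙 _ := by monoidal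
    _ = _ := by
      rw [← whisker_exchange]
      monoidal

lemma bend_unitSquare (x : C) : bend (unitSquare x) = (xᘁ : C) ◁ (λ_ x).hom ≫ ε_ x xᘁ := by
  rw [bend_eq, unitSquare]
  monoidal

lemma bend_hcomp {c d c' d' x : C} (p : c ⊗ x ⟶ x ⊗ d) (q : c' ⊗ x ⟶ x ⊗ d') :
    bend (hcomp p q) =
      𝟙 _ ⊗≫ (xᘁ : C) ◁ (c ◁ (η_ x xᘁ ▷ (c' ⊗ x))) ⊗≫ (bend p ⊗ₘ bend q) := by
  have h : hcomp p q = 𝟙 _ ⊗≫ c ◁ (η_ x xᘁ ▷ (c' ⊗ x)) ⊗≫ (c ⊗ x) ◁ bend q ≫ p ▷ d' ⊗≫ 𝟙 _ := by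
    -- Writing only `q` through its transpose produces the coevaluation in the coproduct formula.
    conv_lhs => rw [eq_bend q]
    rw [hcomp]
    monoidal
  rw [h, tensorHom_def', bend_eq, bend_eq p]
  monoidal

lemma bend_whiskerRight {c c' d x : C} (f : c ⟶ c') (p : c' ⊗ x ⟶ x ⊗ d) :
    bend (f ▷ x ≫ p) = (xᘁ : C) ◁ (f ▷ x) ≫ bend p :=
  tensorLeftHomEquiv_symm_naturality _ _

lemma bend_hcomp_braidSquare [BraidedCategory C] {d x : C} (p : 𝟙_ C ⊗ x ⟶ x ⊗ d) (c : C) :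
    ((xᘁ : C) ◁ (λ_ x).inv ≫ bend p) ▷ c = (α_ _ _ _).hom ≫ (xᘁ : C) ◁ (β_ x c).hom ≫
      (xᘁ : C) ◁ ((λ_ c).inv ▷ x) ≫ bend (hcomp p (braidSquare c x)) := by
  rw [bend_eq, bend_eq, hcomp, braidSquare]
  calc
    -- A cancelling pair of braidings is inserted; its inverse half is the braiding square.
    _ = 𝟙 _ ⊗≫ (xᘁ : C) ◁ ((β_ x c).hom ≫ (β_ x c).inv) ⊗≫ (xᘁ : C) ◁ p ▷ c ⊗≫
        ε_ x xᘁ ▷ (d ⊗ c) ⊗≫ 𝟙 _ := by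
      rw [Iso.hom_inv_id]
      monoidal
    _ = _ := by monoidal

/-- Naturality of the braiding moves `bend q` across `x`, so the crossing of `x` with `e` becomes
that of `x` with `yᘁ ⊗ y`, as in the formula for `μ`. -/
lemma bend_tensorHom_bend [BraidedCategory C] {d e x y : C} (p : 𝟙_ C ⊗ x ⟶ x ⊗ d)
    (q : 𝟙_ C ⊗ y ⟶ y ⊗ e) :
    (((xᘁ : C) ◁ (λ_ x).inv ≫ bend p) ⊗ₘ ((yᘁ : C) ◁ (λ_ y).inv ≫ bend q)) =
      𝟙 _ ⊗≫ (xᘁ : C) ◁ (β_ x (yᘁ ⊗ y)).hom ⊗≫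
        bendTensor (vcomp q ((λ_ e).inv ▷ x ≫ hcomp p (braidSquare e x))) := by
  have h := bend_bend q ((λ_ e).inv ▷ x ≫ hcomp p (braidSquare e x))
  rw [bend_whiskerRight] at h
  rw [tensorHom_def', bend_hcomp_braidSquare]
  calc
    _ = 𝟙 _ ⊗≫ (xᘁ : C) ◁ (x ◁ ((yᘁ : C) ◁ (λ_ y).inv ≫ bend q) ≫ (β_ x e).hom) ≫
        (xᘁ : C) ◁ ((λ_ e).inv ▷ x) ≫ bend (hcomp p (braidSquare e x)) := by monoidal
    _ = 𝟙 _ ⊗≫ (xᘁ : C) ◁ (β_ x (yᘁ ⊗ y)).hom ⊗≫ ((xᘁ : C) ◁ (bend q ▷ x) ≫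
        (xᘁ : C) ◁ ((λ_ e).inv ▷ x) ≫ bend (hcomp p (braidSquare e x))) := by
      rw [BraidedCategory.braiding_naturality_right]
      monoidal
    _ = _ := by
      rw [h]
      monoidal

end DualComparison

lemma structural_comp_injective {C : Type u} [Category.{v} C] {a b d : C}
    [MonoidalCoherence a b] {f g : b ⟶ d} (h : 𝟙 a ⊗≫ f = 𝟙 a ⊗≫ g) : f = g := by
  simpa [monoidalComp] using h

/-! ### Equivalence of the two forms of the defining formulas -/

section

variable {C : Type u} [Category.{v} C] [MonoidalCategory C] [RightRigidCategory C]
  {D : CentralCoends C}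

lemma CentralCoends.bend_r (c x : C) : bend (D.r c x) = D.i c x := D.symm_r c x

/-- Each formula is the transpose of its square version, and transposition is injective. -/
lemma isCentralBimonad_iff (B : BimonadStr D.Z) :
    IsCentralBimonad D B ↔ IsSquareBimonad D B := by
  have hunit (c : C) : B.e.app c = (𝟙 c ⊗≫ (unitDual C).hom ▷ (c ⊗ 𝟙_ C)) ≫ D.i c (𝟙_ C) ↔
      B.e.app c = unitValue (D.r c (𝟙_ C)) := by
    rw [← CentralCoends.bend_r, unitDual_comp_bend]
  have hmul (c x y : C) : ((yᘁ : C) ◁ (D.i c x ▷ y) ≫ D.i (D.Z.obj c) y ≫ B.m.app c =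
      (𝟙 ((yᘁ : C) ⊗ (((xᘁ : C) ⊗ (c ⊗ x)) ⊗ y)) ⊗≫ (tensorDual x y).hom ▷ (c ⊗ (x ⊗ y))) ≫
        D.i c (x ⊗ y)) ↔
      vcomp (D.r c x) (D.r (D.Z.obj c) y) ≫ (x ⊗ y) ◁ B.m.app c = D.r c (x ⊗ y) := by
    have h1 : (yᘁ : C) ◁ (D.i c x ▷ y) ≫ D.i (D.Z.obj c) y ≫ B.m.app c =
        𝟙 _ ⊗≫ bendTensor (vcomp (D.r c x) (D.r (D.Z.obj c) y) ≫ (x ⊗ y) ◁ B.m.app c) := by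
      rw [bendTensor_comp, ← CentralCoends.bend_r, ← CentralCoends.bend_r, ← Category.assoc,
        bend_bend]
      monoidal
    have h2 : (𝟙 ((yᘁ : C) ⊗ (((xᘁ : C) ⊗ (c ⊗ x)) ⊗ y)) ⊗≫
        (tensorDual x y).hom ▷ (c ⊗ (x ⊗ y))) ≫ D.i c (x ⊗ y) =
        𝟙 _ ⊗≫ bendTensor (D.r c (x ⊗ y)) := by
      rw [← tensorDual_comp_bend, CentralCoends.bend_r]
      monoidal
    rw [h1, h2]
    exact ⟨fun h => bendTensor_injective (structural_comp_injective h), fun h => by rw [h]⟩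
  have hcounit (x : C) : D.i (𝟙_ C) x ≫ B.counit = (xᘁ : C) ◁ (λ_ x).hom ≫ ε_ x xᘁ ↔
      D.r (𝟙_ C) x ≫ x ◁ B.counit = unitSquare x := by
    rw [← bend_injective.eq_iff, bend_comp, bend_unitSquare, CentralCoends.bend_r]
  have hcomul (c d x : C) : (D.i (c ⊗ d) x ≫ B.comul c d =
      𝟙 ((xᘁ : C) ⊗ ((c ⊗ d) ⊗ x)) ⊗≫ (xᘁ : C) ◁ (c ◁ (η_ x xᘁ ▷ (d ⊗ x))) ⊗≫
        (D.i c x ⊗ₘ D.i d x)) ↔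
      D.r (c ⊗ d) x ≫ x ◁ B.comul c d = hcomp (D.r c x) (D.r d x) := by
    rw [← bend_injective.eq_iff, bend_comp, bend_hcomp, CentralCoends.bend_r,
      CentralCoends.bend_r, CentralCoends.bend_r]
  exact ⟨fun h => ⟨fun c => (hunit c).1 (h.unit c), fun c x y => (hmul c x y).1 (h.mul c x y),
    fun x => (hcounit x).1 (h.counit x), fun c d x => (hcomul c d x).1 (h.comul c d x)⟩,
    fun h => ⟨fun c => (hunit c).2 (h.unit c), fun c x y => (hmul c x y).2 (h.mul c x y),
    fun x => (hcounit x).2 (h.counit x), fun c d x => (hcomul c d x).2 (h.comul c d x)⟩⟩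

section

variable (D)

lemma unit_formula_iff (e : 𝟙_ C ⟶ D.Z.obj (𝟙_ C)) :
    e = (𝟙 (𝟙_ C) ⊗≫ (unitDual C).hom ▷ 𝟙_ C) ≫ (_ ◁ (λ_ (𝟙_ C)).inv ≫ D.i (𝟙_ C) (𝟙_ C)) ↔
      e = unitValue (D.r (𝟙_ C) (𝟙_ C)) := by
  rw [← unitDual_comp_bend, CentralCoends.bend_r]
  refine iff_of_eq (congrArg (e = ·) ?_)
  monoidal

lemma counit_formula_iff (e : D.Z.obj (𝟙_ C) ⟶ 𝟙_ C) (x : C) :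
    ((xᘁ : C) ◁ (λ_ x).inv ≫ D.i (𝟙_ C) x) ≫ e = ε_ x xᘁ ↔
      D.r (𝟙_ C) x ≫ x ◁ e = unitSquare x := by
  rw [← bend_injective.eq_iff, bend_comp, bend_unitSquare, CentralCoends.bend_r,
    ← cancel_epi ((xᘁ : C) ◁ (λ_ x).hom)]
  simp [← whiskerLeft_comp_assoc]

lemma comul_formula_iff (t : D.Z.obj (𝟙_ C) ⟶ D.Z.obj (𝟙_ C) ⊗ D.Z.obj (𝟙_ C)) (x : C) :
    (((xᘁ : C) ◁ (λ_ x).inv ≫ D.i (𝟙_ C) x) ≫ t =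
      𝟙 ((xᘁ : C) ⊗ x) ⊗≫ (xᘁ : C) ◁ (η_ x xᘁ ▷ x) ⊗≫
        (((xᘁ : C) ◁ (λ_ x).inv ≫ D.i (𝟙_ C) x) ⊗ₘ ((xᘁ : C) ◁ (λ_ x).inv ≫ D.i (𝟙_ C) x))) ↔
    D.r (𝟙_ C) x ≫ x ◁ t = (λ_ (𝟙_ C)).inv ▷ x ≫ hcomp (D.r (𝟙_ C) x) (D.r (𝟙_ C) x) := by
  rw [← bend_injective.eq_iff, bend_comp, bend_whiskerRight, bend_hcomp, CentralCoends.bend_r,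
    ← cancel_epi ((xᘁ : C) ◁ (λ_ x).hom)]
  have h1 : (xᘁ : C) ◁ (λ_ x).hom ≫ ((xᘁ : C) ◁ (λ_ x).inv ≫ D.i (𝟙_ C) x) ≫ t =
    D.i (𝟙_ C) x ≫ t := by simp [← whiskerLeft_comp_assoc]
  rw [h1, ← tensorHom_comp_tensorHom]
  refine iff_of_eq (congrArg (D.i (𝟙_ C) x ≫ t = ·) ?_)
  monoidal

variable [BraidedCategory C]

lemma mul_formula_iff (m : D.Z.obj (𝟙_ C) ⊗ D.Z.obj (𝟙_ C) ⟶ D.Z.obj (𝟙_ C)) (x y : C) :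
    (((xᘁ : C) ◁ (λ_ x).inv ≫ D.i (𝟙_ C) x) ⊗ₘ ((yᘁ : C) ◁ (λ_ y).inv ≫ D.i (𝟙_ C) y)) ≫ m =
      (𝟙 (((xᘁ : C) ⊗ x) ⊗ ((yᘁ : C) ⊗ y)) ⊗≫ (xᘁ : C) ◁ (β_ x ((yᘁ : C) ⊗ y)).hom ⊗≫
        (tensorDual y x).hom ▷ (y ⊗ x)) ≫ (_ ◁ (λ_ (y ⊗ x)).inv ≫ D.i (𝟙_ C) (y ⊗ x)) ↔
    vcomp (D.r (𝟙_ C) y) ((λ_ (D.Z.obj (𝟙_ C))).inv ▷ x ≫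
      hcomp (D.r (𝟙_ C) x) (braidSquare (D.Z.obj (𝟙_ C)) x)) ≫ (y ⊗ x) ◁ m =
        D.r (𝟙_ C) (y ⊗ x) := by
  have h1 : (((xᘁ : C) ◁ (λ_ x).inv ≫ D.i (𝟙_ C) x) ⊗ₘ
      ((yᘁ : C) ◁ (λ_ y).inv ≫ D.i (𝟙_ C) y)) ≫ m =
      𝟙 _ ⊗≫ (xᘁ : C) ◁ (β_ x ((yᘁ : C) ⊗ y)).hom ⊗≫
        bendTensor (vcomp (D.r (𝟙_ C) y) ((λ_ (D.Z.obj (𝟙_ C))).inv ▷ x ≫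
          hcomp (D.r (𝟙_ C) x) (braidSquare (D.Z.obj (𝟙_ C)) x)) ≫ (y ⊗ x) ◁ m) := by
    rw [bendTensor_comp, ← CentralCoends.bend_r, ← CentralCoends.bend_r, bend_tensorHom_bend]
    monoidal
  have h2 : (𝟙 (((xᘁ : C) ⊗ x) ⊗ ((yᘁ : C) ⊗ y)) ⊗≫ (xᘁ : C) ◁ (β_ x ((yᘁ : C) ⊗ y)).hom ⊗≫
        (tensorDual y x).hom ▷ (y ⊗ x)) ≫ (_ ◁ (λ_ (y ⊗ x)).inv ≫ D.i (𝟙_ C) (y ⊗ x)) =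
      𝟙 _ ⊗≫ (xᘁ : C) ◁ (β_ x ((yᘁ : C) ⊗ y)).hom ⊗≫
        bendTensor (D.r (𝟙_ C) (y ⊗ x)) := by
    rw [← tensorDual_comp_bend, CentralCoends.bend_r]
    monoidal
  rw [h1, h2]
  refine ⟨fun h => bendTensor_injective ?_, fun h => by rw [h]⟩
  exact (cancel_epi _).1 ((cancel_epi ((xᘁ : C) ◁ (β_ x ((yᘁ : C) ⊗ y)).hom)).1
    (structural_comp_injective h))

end

variable [BraidedCategory C]

lemma isCanonicalBialgebra_iff (H : BimonObj D.L) :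
    IsCanonicalBialgebra D H ↔ IsSquareBialgebra D H :=
  ⟨fun h => ⟨(unit_formula_iff D _).1 h.one, fun x y => (mul_formula_iff D _ x y).1 (h.mul x y),
    fun x => (counit_formula_iff D _ x).1 (h.counit x),
    fun x => (comul_formula_iff D _ x).1 (h.comul x)⟩,
  fun h => ⟨(unit_formula_iff D _).2 h.one, fun x y => (mul_formula_iff D _ x y).2 (h.mul x y),
    fun x => (counit_formula_iff D _ x).2 (h.counit x),
    fun x => (comul_formula_iff D _ x).2 (h.comul x)⟩⟩

lemma CentralCoends.i_zeta (c x : C) :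
    ((xᘁ : C) ◁ (λ_ x).inv ≫ D.i (𝟙_ C) x) ▷ c ≫ (D.zeta c).hom =
      (α_ (xᘁ : C) x c).hom ≫ (xᘁ : C) ◁ (β_ x c).hom ≫ D.i c x := by
  rw [← bend_r, bend_hcomp_braidSquare, Category.assoc, Category.assoc, Category.assoc,
    ← bend_comp, hcomp_zeta, bend_whiskerRight, bend_r]
  simp

lemma CentralCoends.i_zeta_inv (c x : C) :
    D.i c x ≫ (D.zeta c).inv = (xᘁ : C) ◁ (β_ x c).inv ≫ (α_ (xᘁ : C) x c).inv ≫
      ((xᘁ : C) ◁ (λ_ x).inv ≫ D.i (𝟙_ C) x) ▷ c := by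
  rw [Iso.comp_inv_eq, Category.assoc, Category.assoc, i_zeta]
  simp [← whiskerLeft_comp_assoc]

end

end BraidedFTC

end

/-! ### The main theorem -/

open BraidedFTC in
theorem mainTheorem8 (k : Type w) [Field k] [IsAlgClosed k]
    (C : Type u) [Category.{v} C] [Abelian C] [Linear k C] [MonoidalCategory C]
    [MonoidalPreadditive C] [MonoidalLinear k C] [RigidCategory C] [BraidedCategory C]
    [IsFiniteTensorCategory k C] :
    -- the coends `Z c` exist, and for every choice of them:
    Nonempty (CentralCoends C) ∧ ∀ D : CentralCoends C,
      -- the defining formulas determine a unique bimonad structure on `Z`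
      (∃! B : BimonadStr D.Z, IsCentralBimonad D B) ∧
      -- the defining formulas determine a unique bialgebra structure on `L`
      (∃! H : BimonObj D.L, IsCanonicalBialgebra D H) ∧
      -- and `L ⊗ -` and `Z` are isomorphic as bimonads via `ζ` and `ξ`
      ∀ (B : BimonadStr D.Z) (H : BimonObj D.L),
        IsCentralBimonad D B → IsCanonicalBialgebra D H →
          ∃ (ζ : tensorLeft D.L ⟶ D.Z) (ξ : D.Z ⟶ tensorLeft D.L),
            (∀ c x : C, D.iL x ▷ c ≫ ζ.app c =
              (α_ xᘁ x c).hom ≫ xᘁ ◁ (β_ x c).hom ≫ D.i c x) ∧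
            (∀ c x : C, D.i c x ≫ ξ.app c =
              xᘁ ◁ (β_ x c).inv ≫ (α_ xᘁ x c).inv ≫ D.iL x ▷ c) ∧
            ζ ≫ ξ = 𝟙 (tensorLeft D.L) ∧ ξ ≫ ζ = 𝟙 D.Z ∧
            IsBimonadHom (tensorBimonad D.L) B ζ ∧ IsBimonadHom B (tensorBimonad D.L) ξ := by
  refine ⟨nonempty_centralCoends k, fun D => ⟨?_, ?_, fun B H hB hH => ?_⟩⟩
  · exact ⟨D.bimonad, (isCentralBimonad_iff _).2 D.bimonad_isSquareBimonad,
      fun B hB => ((isCentralBimonad_iff B).1 hB).eq D.bimonad_isSquareBimonad⟩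
  · exact ⟨D.bialgebra, (isCanonicalBialgebra_iff _).2 D.bialgebra_isSquareBialgebra,
      fun H hH => ((isCanonicalBialgebra_iff H).1 hH).eq D.bialgebra_isSquareBialgebra⟩
  · have hζ := CentralCoends.zetaIso_isBimonadHom ((isCentralBimonad_iff B).1 hB)
      ((isCanonicalBialgebra_iff H).1 hH)
    have hinv := D.zetaIso.hom_inv_id
    have hinv' := D.zetaIso.inv_hom_id
    exact ⟨D.zetaIso.hom, D.zetaIso.inv, D.i_zeta, D.i_zeta_inv, hinv, hinv', hζ,
      hζ.inv hinv hinv'⟩
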